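/- \textbf{Theorem 1.} Consider repeated Uniform Pricing with binary feedback and $N$ buyers. An instance is a tuple $(\mathcal D_1,\dots,\mathcal D_N)$ of distributions on $[0,1]$, possibly different but all belonging to one family. In each round $t$ the platform posts a price $p_t\in[0,1]$, fresh independent bids $B_t^i\sim\mathcal D_i$ are drawn, and the platform observes only $z_t=\mathbf 1\{\max_i B_t^i\ge p_t\}$. The price $p_t$ may depend on $p_1,z_1,\dots,p_{t-1},z_{t-1}$ and on internal randomness. Let $r(p)=p\cdot\Pr[\max_i B^i\ge p]$ and $r(p^*)=\max_{p\in[0,1]}r(p)$. For a distribution with left-continuous CDF $F(x)=\Pr[X<x]$, let $f(x)\in[0,\infty]$ be its generalized density on $[0,1]$, that is, the right-hand derivative of $F$, required to exist in $[0,\infty]$ (so $f=F'$ where $F$ is differentiable, and $f=\infty$ at jumps). The distribution is \emph{regular} if $x-\frac{1-F(x)}{f(x)}$ is non-decreasing on $[0,1]$ (the quotient being $0$ where $F(x)=1$), and \emph{MHR} if $\frac{f(x)}{1-F(x)}$ is non-decreasing on $\{x\in[0,1]:F(x)<1\}$. The \emph{pricing query complexity} at accuracy $\varepsilon$ is the least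 worst-case number of rounds, over the instances of the family, of an algorithm that stops at a stopping time $\tau$ of the filtration $\sigma(p_1,z_1,\dots,p_t,z_t)$ and, on every instance of the family, outputs with probability at least $0.95$ a price $\hat p\in[0,1]$ with $|r(\hat p)-r(p^*)|\le\varepsilon$; the number of rounds is measured either by the expectation $\mathbb E[\tau]$ or by a sure upper bound on $\tau$. The \emph{minimax regret} is \[R(T)=\inf_{\text{policies}}\ \sup_{\text{instances}}\Bigl(T\,r(p^*)-\mathbb E\Bigl[\sum_{t=1}^T r(p_t)\Bigr]\Bigr).\] Then, for the family of regular distributions and every $N\ge2$, and for the family of MHR distributions and every $N\ge3$, the pricing query complexity (in both measures) is $\Theta(\varepsilon^{-3})$ as $\varepsilon\to0$ and the minimax regret is $\Theta(T^{2/3})$ as $T\to\infty$. The same bounds hold for the family of all distributions on $[0,1]$ and every $N\ge2$. The constants, and the ranges of small $\varepsilon$ and large $T$, are absolute; in particular they do not depend on $N$. -/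

import Mathlib

open MeasureTheory Set Filter Topology
open scoped ENNReal unitInterval

noncomputable section

namespace UniformPricing

/-! ### Bid distributions -/

/-- The left-continuous CDF `F(x) = Pr[X < x]`. -/
def leftCDF (D : ProbabilityMeasure ℝ) (x : ℝ) : ℝ :=
  (D : Measure ℝ).real (Iio x)

/-- `f` is the generalized density on `[0,1]` of the distribution with left-continuous CDF `F`:
the right-hand derivative of `F`, as a limit in `[0,∞]`. In particular `f(x) = F'(x)` at points
of differentiability and, `F` being left-continuous, `f(x) = ∞` at jumps. -/
def IsGenDensity (F : ℝ → ℝ) (f : ℝ → ℝ≥0∞) : Prop :=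
  ∀ x ∈ Icc (0 : ℝ) 1,
    Tendsto (fun s => ENNReal.ofReal ((F s - F x) / (s - x))) (𝓝[>] x) (𝓝 (f x))

/-- The virtual value `x - (1 - F(x)) / f(x)`, in `[-∞,∞)`. The quotient is taken in `[0,∞]`: it is
`∞` if `f(x) = 0` and `F(x) < 1`, and `0` if `F(x) = 1` or `f(x) = ∞`. -/
def virtualValue (F : ℝ → ℝ) (f : ℝ → ℝ≥0∞) (x : ℝ) : EReal :=
  (x : EReal) - ((ENNReal.ofReal (1 - F x) / f x : ℝ≥0∞) : EReal)

/-- The hazard rate `f(x) / (1 - F(x))`, in `[0,∞]`, at points with `F(x) < 1`. -/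
def hazardRate (F : ℝ → ℝ) (f : ℝ → ℝ≥0∞) (x : ℝ) : ℝ≥0∞ :=
  f x / ENNReal.ofReal (1 - F x)

/-- All probability distributions supported on `[0,1]`. -/
def generalFamily : Set (ProbabilityMeasure ℝ) :=
  {D | (D : Measure ℝ) (Icc 0 1) = 1}

/-- Regular distributions on `[0,1]`: the virtual value is non-decreasing. -/
def regularFamily : Set (ProbabilityMeasure ℝ) :=
  {D | D ∈ generalFamily ∧ ∃ f, IsGenDensity (leftCDF D) f ∧
    MonotoneOn (virtualValue (leftCDF D) f) (Icc 0 1)}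

/-- MHR distributions on `[0,1]`: the hazard rate is non-decreasing wherever it is defined. -/
def mhrFamily : Set (ProbabilityMeasure ℝ) :=
  {D | D ∈ generalFamily ∧ ∃ f, IsGenDensity (leftCDF D) f ∧
    MonotoneOn (hazardRate (leftCDF D) f) {x ∈ Icc 0 1 | leftCDF D x < 1}}

/-- Instances: `N` buyers with possibly different distributions, all from the family `𝓓`. -/
def Instances (𝓓 : Set (ProbabilityMeasure ℝ)) (N : ℕ) : Set (Fin N → ProbabilityMeasure ℝ) :=
  {D | ∀ i, D i ∈ 𝓓}

/-- The joint law of the bids of one round: independent bids `B^i ∼ D i`. -/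
def roundLaw {N : ℕ} (D : Fin N → ProbabilityMeasure ℝ) : Measure (Fin N → ℝ) :=
  Measure.pi fun i => (D i : Measure ℝ)

instance {N : ℕ} (D : Fin N → ProbabilityMeasure ℝ) : IsProbabilityMeasure (roundLaw D) := by
  unfold roundLaw; infer_instance

/-- The expected one-round revenue `r(p) = p · Pr[max_i B^i ≥ p]`. -/
def revenue {N : ℕ} (D : Fin N → ProbabilityMeasure ℝ) (p : I) : ℝ :=
  p * (roundLaw D).real {b | ∃ i, (p : ℝ) ≤ b i}

/-- The optimal revenue `r(p*)`, the largest value of `r` on `[0,1]`. -/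
def optRevenue {N : ℕ} (D : Fin N → ProbabilityMeasure ℝ) : ℝ :=
  ⨆ p : I, revenue D p

/-! ### Pricing policies -/

/-- The prices posted and the binary feedbacks received in the first `t` rounds. -/
abbrev History (t : ℕ) : Type := Fin t → I × Bool

/-- A randomized adaptive policy: the price of round `t` (rounds are numbered from `0`) is a
measurable function of an internal random seed and of the history of the `t` previous rounds. -/
structure Policy where
  /-- the space of seeds -/
  Seed : Type
  [mSeed : MeasurableSpace Seed]
  /-- the law of the seed -/
  seedLaw : ProbabilityMeasure Seed
  /-- the price of round `t` -/
  price : (t : ℕ) → Seed → History t → I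
  measurable_price : ∀ t, Measurable (Function.uncurry (price t))

attribute [instance] Policy.mSeed

/-- The sample space: the seed, and the bid `B_t^i` of each buyer `i` in each round `t`. -/
abbrev Policy.Sample (A : Policy) (N : ℕ) : Type := A.Seed × (ℕ → Fin N → ℝ)

/-- The law of the sample: the seed and the bids of all the rounds are independent, and the bids
of each round are distributed according to the instance `D`. -/
def Policy.law (A : Policy) {N : ℕ} (D : Fin N → ProbabilityMeasure ℝ) :
    Measure (A.Sample N) :=
  (A.seedLaw : Measure A.Seed).prod (Measure.infinitePi fun _ : ℕ => roundLaw D)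

open Classical in
/-- The history generated by the policy; the feedback to a price `p` is `1{max_i B_t^i ≥ p}`. -/
def Policy.history (A : Policy) {N : ℕ} (ω : A.Sample N) : (t : ℕ) → History t
  | 0 => Fin.elim0
  | t + 1 =>
    let h := A.history ω t
    let p := A.price t ω.1 h
    Fin.snoc (α := fun _ => I × Bool) h (p, decide (∃ i, (p : ℝ) ≤ ω.2 t i))

/-- The price that the policy posts in round `t`. -/
def Policy.postedPrice (A : Policy) {N : ℕ} (ω : A.Sample N) (t : ℕ) : I :=
  A.price t ω.1 (A.history ω t)

/-! ### Regret -/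

/-- The regret `T · r(p*) - E[∑ r(p_t)]` of a policy on an instance over `T` rounds. -/
def Policy.regret (A : Policy) {N : ℕ} (D : Fin N → ProbabilityMeasure ℝ) (T : ℕ) : ℝ :=
  T * optRevenue D - ∫ ω, ∑ t ∈ Finset.range T, revenue D (A.postedPrice ω t) ∂(A.law D)

/-- The minimax regret: the worst-case regret over the family of the best policy. The policy may
depend on `T`, on `N` and on the family, but not on the instance. -/
def minimaxRegret (𝓓 : Set (ProbabilityMeasure ℝ)) (N T : ℕ) : EReal :=
  ⨅ A : Policy, ⨆ D ∈ Instances 𝓓 N, (A.regret D T : EReal)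

/-! ### Pricing query complexity -/

/-- An algorithm that searches for a good price: a policy with a rule that says, from the prices
and feedbacks so far, whether to terminate, and with a (possibly randomized) output price. -/
structure PriceFinder extends Policy where
  /-- the histories of length `t` at which the algorithm terminates -/
  halt : (t : ℕ) → Set (History t)
  measurableSet_halt : ∀ t, MeasurableSet (halt t)
  /-- the output after terminating with a history of length `t` -/
  output : (t : ℕ) → Seed → History t → I
  measurable_output : ∀ t, Measurable (Function.uncurry (output t))

/-- The number of queries: the first `t` at which the algorithm terminates, `∞` if it never does.
It is a stopping time for the filtration `σ(p_1, z_1, …, p_t, z_t)`. -/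
def PriceFinder.queries (A : PriceFinder) {N : ℕ} (ω : A.Sample N) : ℕ∞ :=
  ⨅ (t : ℕ) (_ : A.history ω t ∈ A.halt t), (t : ℕ∞)

/-- The event that the algorithm terminates with a price whose revenue is within `ε` of `r(p*)`. -/
def PriceFinder.success (A : PriceFinder) {N : ℕ} (D : Fin N → ProbabilityMeasure ℝ) (ε : ℝ) :
    Set (A.Sample N) :=
  {ω | ∃ t : ℕ, A.queries ω = t ∧
    |revenue D (A.output t ω.1 (A.history ω t)) - optRevenue D| ≤ ε}

/-- On every instance of the family, the algorithm succeeds with probability at least `0.95`. -/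
def PriceFinder.Solves (A : PriceFinder) (𝓓 : Set (ProbabilityMeasure ℝ)) (N : ℕ) (ε : ℝ) : Prop :=
  ∀ D ∈ Instances 𝓓 N, 0.95 ≤ (A.law D).real (A.success D ε)

/-- The pricing query complexity: the least worst-case expected number of queries. -/
def queryComplexity (𝓓 : Set (ProbabilityMeasure ℝ)) (N : ℕ) (ε : ℝ) : ℝ≥0∞ :=
  ⨅ (A : PriceFinder) (_ : A.Solves 𝓓 N ε), ⨆ D ∈ Instances 𝓓 N,
    ∫⁻ ω, (A.queries ω : ℝ≥0∞) ∂(A.law D)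

/-- The pricing query complexity with a sure bound on the number of queries in place of a bound on
its expectation. -/
def sureQueryComplexity (𝓓 : Set (ProbabilityMeasure ℝ)) (N : ℕ) (ε : ℝ) : ℝ≥0∞ :=
  ⨅ (A : PriceFinder) (_ : A.Solves 𝓓 N ε), ⨆ ω : A.Sample N, (A.queries ω : ℝ≥0∞)

end UniformPricing

end

/-!
All three rates come from two facts about bandits with `K` arms: regret `O(√(K T))` can be achieved
without logarithmic factors, and `K` disjoint windows of prices can hide a needle.

*Upper bounds.* Lowering a price by `1/K` costs at most `1/K` of revenue, so a grid of
`K ≈ T^{1/3}` prices loses `O(T^{2/3})` in `T` rounds. On the grid, follow-the-regularized-leader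
with the Tsallis entropy of order `1/2` has regret `O(√(K T)) = O(T^{2/3})`. Its analysis
uses the dual `y ↦ y - ∑ᵢ 1 / (η² (Lᵢ - y))` of the regularized minimization at cumulative loss
estimates `L`: the maximum over `y` is a potential that never exceeds any `Lⱼ`, and keeping the old
dual variable after a round shows that it grows by at least the expected loss of the round minus
`η √K` (`potential_add_le`, `exists_policy_regret_arms`). Outputting a uniformly random price among
those posted turns regret into query complexity (`uniformStop_success`), which gives
`O(ε⁻³)` queries. The same conversion turns the lower bound for queries into the one for regret.

*Lower bound for queries.* Under the base instance the maximal bid has CDF `1 - 1/(2x)` on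
`[1/2, 1]`, so that all these prices have revenue `1/2`. The instance with a needle at `p` agrees
with it outside a window `(p - w, p]`, where the probability of a sale changes by `O(w)`, and
has revenue `1/2 + Ω(w)` at `p`. It has a buyer whose CDF climbs to `1` with a positive slope
at `p`, except that from `p - w` on its hazard rate is frozen at order `1/w`, which
leaves an atom of mass of order `w` at `p`, and a partner whose CDF restores the flat product and has
a convex kink at `p`. Two regular buyers can realize this; for MHR buyers the flat CDF is itself split
into two MHR factors. With `w` of order `ε`, near-optimal prices lie in the window, and there are
`Ω(1/ε)` disjoint windows. The probability under the needle instance of an event that depends on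
`T` rounds is at most twice the sum of its probability under the base instance and of the expected
divergence collected in the window (`law_real_le_of_divergenceBound`); summing over the windows
gives `T ≥ Ω(1/w³)` (`card_le_of_solves_needles`).
-/

noncomputable section

namespace UniformPricing

/-! ### Histories, one round at a time -/

theorem measurable_update_pair {X : Type*} [MeasurableSpace X] (t : ℕ) :
    Measurable fun z : (ℕ → X) × X => Function.update z.1 t z.2 := by
  refine measurable_pi_iff.2 fun i => ?_
  by_cases h : i = t
  · subst h; simpa using measurable_snd
  · have : Measurable fun z : (ℕ → X) × X => z.1 i := (measurable_pi_apply i).comp measurable_fst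
    simpa [Function.update_of_ne h] using this

/-- Resampling one coordinate does not change an infinite product measure. -/
theorem infinitePi_prod_map_update {X : Type*} [MeasurableSpace X] (ν : Measure X)
    [IsProbabilityMeasure ν] (t : ℕ) :
    ((Measure.infinitePi fun _ : ℕ => ν).prod ν).map
      (fun z : (ℕ → X) × X => Function.update z.1 t z.2) = Measure.infinitePi fun _ : ℕ => ν := by
  have hm := measurable_update_pair (X := X) t
  refine Measure.eq_infinitePi _ fun s T hT => ?_
  rw [Measure.map_apply hm (MeasurableSet.pi s.countable_toSet fun i _ => hT i)]
  by_cases hts : t ∈ s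
  · have : (fun z : (ℕ → X) × X => Function.update z.1 t z.2) ⁻¹' (Set.pi s T)
        = (Set.pi (s.erase t) T) ×ˢ (T t) := by
      ext ⟨x, y⟩
      simp only [mem_preimage, Set.mem_pi, mem_prod, Finset.mem_coe, Finset.mem_erase]
      constructor
      · intro h
        refine ⟨fun i hi => ?_, by simpa using h t hts⟩
        simpa [Function.update_of_ne hi.1] using h i hi.2
      · rintro ⟨h1, h2⟩ i hi
        by_cases h : i = t
        · subst h; simpa using h2
        · simpa [Function.update_of_ne h] using h1 i ⟨h, hi⟩
    rw [this, Measure.prod_prod, Measure.infinitePi_pi (fun _ : ℕ => ν) (fun i _ => hT i),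
      ← Finset.prod_erase_mul _ _ hts]
  · have : (fun z : (ℕ → X) × X => Function.update z.1 t z.2) ⁻¹' (Set.pi s T)
        = (Set.pi s T) ×ˢ univ := by
      ext ⟨x, y⟩
      simp only [mem_preimage, Set.mem_pi, mem_prod, Finset.mem_coe, mem_univ, and_true]
      refine forall₂_congr fun i hi => ?_
      rw [Function.update_of_ne (fun h : i = t => hts (h ▸ Finset.mem_coe.1 hi))]
    rw [this, Measure.prod_prod, measure_univ, mul_one,
      Measure.infinitePi_pi (fun _ : ℕ => ν) (fun i _ => hT i)]

/-- A bounded measurable real function is integrable for a probability measure. -/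
theorem integrable_of_abs_le {Ω : Type*} [MeasurableSpace Ω] {μ : Measure Ω}
    [IsProbabilityMeasure μ] {f : Ω → ℝ} (hf : Measurable f) {C : ℝ} (hC : ∀ x, |f x| ≤ C) :
    Integrable f μ :=
  Integrable.of_bound hf.aestronglyMeasurable C (ae_of_all _ hC)

/-- Coordinate `t` of an i.i.d. sequence is independent of whatever does not depend on it. -/
theorem integral_infinitePi_resample {X : Type*} [MeasurableSpace X] (ν : Measure X)
    [IsProbabilityMeasure ν] (t : ℕ) (F : (ℕ → X) → X → ℝ)
    (hF : Measurable (Function.uncurry F)) {C : ℝ} (hC : ∀ x y, |F x y| ≤ C)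
    (hinv : ∀ x y z, F (Function.update x t z) y = F x y) :
    ∫ x, F x (x t) ∂(Measure.infinitePi fun _ : ℕ => ν)
      = ∫ x, ∫ y, F x y ∂ν ∂(Measure.infinitePi fun _ : ℕ => ν) := by
  have hm := measurable_update_pair (X := X) t
  have hm2 : Measurable fun x : ℕ → X => F x (x t) :=
    hF.comp (measurable_id.prodMk (measurable_pi_apply t))
  conv_lhs => rw [← infinitePi_prod_map_update ν t]
  rw [integral_map hm.aemeasurable hm2.aestronglyMeasurable]
  have : (fun z : (ℕ → X) × X => F (Function.update z.1 t z.2) (Function.update z.1 t z.2 t))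
      = Function.uncurry F := by
    ext ⟨x, y⟩
    simp [hinv, Function.uncurry]
  rw [this, integral_prod _ (integrable_of_abs_le hF fun z => hC _ _)]
  rfl

/-- The integral of a function of the truth value of an event. -/
theorem integral_bool_of_event {X : Type*} [MeasurableSpace X] (ν : Measure X)
    [IsProbabilityMeasure ν] {S : Set X} (hS : MeasurableSet S) [DecidablePred (· ∈ S)]
    (g : Bool → ℝ) :
    ∫ y, g (decide (y ∈ S)) ∂ν = ν.real S * g true + (1 - ν.real S) * g false := by
  have : (fun y => g (decide (y ∈ S)))
      = fun y => S.indicator (fun _ => g true - g false) y + g false := by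
    ext y
    by_cases h : y ∈ S <;> simp [h]
  rw [this, integral_add ((integrable_const _).indicator hS) (integrable_const _),
    integral_indicator_const _ hS]
  simp
  ring

section History

variable {N : ℕ} (A : Policy) (D : Fin N → ProbabilityMeasure ℝ)

instance : IsProbabilityMeasure (A.law D) := by
  unfold Policy.law; infer_instance

/-- The probability `Pr[max_i B^i ≥ p]` that a price is accepted. -/
def saleProb (p : I) : ℝ := (roundLaw D).real {b | ∃ i, (p : ℝ) ≤ b i}

theorem saleProb_nonneg (p : I) : 0 ≤ saleProb D p := measureReal_nonneg

theorem saleProb_le_one (p : I) : saleProb D p ≤ 1 := measureReal_le_one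

theorem antitone_saleProb : Antitone (saleProb D) := by
  intro p p' h
  refine measureReal_mono ?_
  rintro b ⟨i, hi⟩
  exact ⟨i, le_trans (by exact_mod_cast h) hi⟩

theorem measurable_saleProb : Measurable (saleProb D) := (antitone_saleProb D).measurable

theorem revenue_eq (p : I) : revenue D p = p * saleProb D p := rfl

theorem revenue_nonneg (p : I) : 0 ≤ revenue D p := mul_nonneg p.2.1 (saleProb_nonneg D p)

theorem revenue_le_one (p : I) : revenue D p ≤ 1 :=
  mul_le_one₀ p.2.2 (saleProb_nonneg D p) (saleProb_le_one D p)

theorem measurable_revenue : Measurable (revenue D) :=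
  measurable_subtype_coe.mul (measurable_saleProb D)

theorem revenue_le_optRevenue (p : I) : revenue D p ≤ optRevenue D :=
  le_ciSup (f := fun p => revenue D p)
    ⟨1, by rintro _ ⟨p, rfl⟩; exact revenue_le_one D p⟩ p

/-- The history after one more round, in which the price `p` is posted and the feedback is `z`. -/
def extend {t : ℕ} (h : History t) (p : I) (z : Bool) : History (t + 1) :=
  Fin.snoc (α := fun _ => I × Bool) h (p, z)

theorem measurable_extend (t : ℕ) :
    Measurable fun x : History t × I × Bool => extend x.1 x.2.1 x.2.2 := by
  refine measurable_pi_iff.2 fun i => ?_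
  refine Fin.lastCases ?_ (fun j => ?_) i
  · simpa [extend] using measurable_snd
  · have : Measurable fun x : History t × I × Bool => x.1 j :=
      (measurable_pi_apply j).comp measurable_fst
    simpa [extend] using this

theorem measurableSet_accept : MeasurableSet {x : I × (Fin N → ℝ) | ∃ i, (x.1 : ℝ) ≤ x.2 i} := by
  rw [ofPred_exists]
  refine MeasurableSet.iUnion fun i => measurableSet_le ?_ ?_
  · exact measurable_subtype_coe.comp measurable_fst
  · exact (measurable_pi_apply i).comp measurable_snd

open Classical in
theorem measurable_accept :
    Measurable fun x : I × (Fin N → ℝ) => decide (∃ i, (x.1 : ℝ) ≤ x.2 i) := by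
  refine measurable_to_bool ?_
  convert measurableSet_accept (N := N) using 1
  ext x
  simp

open Classical in
theorem history_succ (ω : A.Sample N) (t : ℕ) :
    A.history ω (t + 1) = extend (A.history ω t) (A.postedPrice ω t)
      (decide (∃ i, (A.postedPrice ω t : ℝ) ≤ ω.2 t i)) := rfl

theorem measurable_history (t : ℕ) : Measurable fun ω : A.Sample N => A.history ω t := by
  induction t with
  | zero => exact measurable_pi_iff.2 fun i => i.elim0
  | succ t ih =>
    have hp : Measurable fun ω : A.Sample N => A.postedPrice ω t :=
      (A.measurable_price t).comp (measurable_fst.prodMk ih)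
    simp only [history_succ]
    refine (measurable_extend t).comp (ih.prodMk (hp.prodMk ?_))
    exact measurable_accept.comp
      (hp.prodMk ((measurable_pi_apply t).comp measurable_snd))

theorem measurable_postedPrice (t : ℕ) : Measurable fun ω : A.Sample N => A.postedPrice ω t :=
  (A.measurable_price t).comp (measurable_fst.prodMk (measurable_history A t))

theorem history_update (s : A.Seed) (b : ℕ → Fin N → ℝ) {t u : ℕ} (htu : t ≤ u) (y : Fin N → ℝ) :
    A.history (s, Function.update b u y) t = A.history (s, b) t := by
  induction t with
  | zero => rfl
  | succ t ih =>
    have h := ih (by omega)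
    have hp : A.postedPrice (s, Function.update b u y) t = A.postedPrice (s, b) t := by
      simp only [Policy.postedPrice, h]
    rw [history_succ, history_succ, h, hp]
    have : Function.update b u y t = b t := Function.update_of_ne (by omega) _ _
    simp only [this]

/-- The conditional expectation, given the past, of a function of the next feedback. -/
def stepMean {t : ℕ} (f : A.Seed → History (t + 1) → ℝ) (s : A.Seed) (h : History t) : ℝ :=
  saleProb D (A.price t s h) * f s (extend h (A.price t s h) true)
    + (1 - saleProb D (A.price t s h)) * f s (extend h (A.price t s h) false)

theorem measurable_stepMean {t : ℕ} {f : A.Seed → History (t + 1) → ℝ}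
    (hf : Measurable (Function.uncurry f)) :
    Measurable (Function.uncurry (stepMean A D f)) := by
  have hp := A.measurable_price t
  have hq := (measurable_saleProb D).comp hp
  have he : ∀ z : Bool, Measurable fun x : A.Seed × History t =>
      f x.1 (extend x.2 (A.price t x.1 x.2) z) := fun z =>
    hf.comp (measurable_fst.prodMk ((measurable_extend t).comp
      (measurable_snd.prodMk (hp.prodMk measurable_const))))
  exact (hq.mul (he true)).add ((measurable_const.sub hq).mul (he false))

theorem stepMean_mem_Icc {t : ℕ} {f : A.Seed → History (t + 1) → ℝ} {a b : ℝ}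
    (hf : ∀ s h, f s h ∈ Icc a b) (s : A.Seed) (h : History t) :
    stepMean A D f s h ∈ Icc a b := by
  unfold stepMean
  have h0 := saleProb_nonneg D (A.price t s h)
  have h1 := saleProb_le_one D (A.price t s h)
  have ht := hf s (extend h (A.price t s h) true)
  have hf := hf s (extend h (A.price t s h) false)
  constructor
  · nlinarith [ht.1, hf.1]
  · nlinarith [ht.2, hf.2]

/-- The bids of round `t` are independent of the first `t` rounds, for each value of the seed. -/
theorem integral_history_succ_of_seed {t : ℕ} {f : History (t + 1) → ℝ} (s : A.Seed)
    (hf : Measurable f) {C : ℝ} (hC : ∀ h, |f h| ≤ C) :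
    ∫ b, f (A.history (s, b) (t + 1)) ∂(Measure.infinitePi fun _ : ℕ => roundLaw D)
      = ∫ b, stepMean A D (fun _ => f) s (A.history (s, b) t)
        ∂(Measure.infinitePi fun _ : ℕ => roundLaw D) := by
  classical
  have hh : Measurable fun b : ℕ → Fin N → ℝ => A.history (s, b) t :=
    (measurable_history A t).comp (measurable_const.prodMk measurable_id)
  have hp : Measurable fun b : ℕ → Fin N → ℝ => A.postedPrice (s, b) t :=
    (measurable_postedPrice A t).comp (measurable_const.prodMk measurable_id)
  have hF : Measurable (Function.uncurry fun (b : ℕ → Fin N → ℝ) (y : Fin N → ℝ) =>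
      f (extend (A.history (s, b) t) (A.postedPrice (s, b) t)
        (decide (∃ i, (A.postedPrice (s, b) t : ℝ) ≤ y i)))) := by
    refine hf.comp ((measurable_extend t).comp
      ((hh.comp measurable_fst).prodMk ((hp.comp measurable_fst).prodMk ?_)))
    exact measurable_accept.comp ((hp.comp measurable_fst).prodMk measurable_snd)
  have key := integral_infinitePi_resample (roundLaw D) t _ hF (C := C) (fun _ _ => hC _) (by
    intro b y z
    simp only [Policy.postedPrice, history_update A s b le_rfl]
    congr!)
  have h1 : (fun b : ℕ → Fin N → ℝ => f (A.history (s, b) (t + 1)))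
      = fun b => f (extend (A.history (s, b) t) (A.postedPrice (s, b) t)
        (decide (∃ i, (A.postedPrice (s, b) t : ℝ) ≤ b t i))) := by
    funext b
    rw [history_succ]
  rw [h1, key]
  congr 1
  funext b
  have hS : MeasurableSet {y : Fin N → ℝ | ∃ i, (A.postedPrice (s, b) t : ℝ) ≤ y i} :=
    measurableSet_accept.preimage (measurable_const.prodMk measurable_id)
  exact integral_bool_of_event (roundLaw D) hS
    (fun z => f (extend (A.history (s, b) t) (A.postedPrice (s, b) t) z))

/-- The bids of round `t` are independent of the seed and of the first `t` rounds. -/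
theorem integral_history_succ {t : ℕ} {f : A.Seed → History (t + 1) → ℝ}
    (hf : Measurable (Function.uncurry f)) {C : ℝ} (hC : ∀ s h, |f s h| ≤ C) :
    ∫ ω, f ω.1 (A.history ω (t + 1)) ∂(A.law D)
      = ∫ ω, stepMean A D f ω.1 (A.history ω t) ∂(A.law D) := by
  have hm1 : Measurable fun ω : A.Sample N => f ω.1 (A.history ω (t + 1)) :=
    hf.comp (measurable_fst.prodMk (measurable_history A (t + 1)))
  have hm2 : Measurable fun ω : A.Sample N => stepMean A D f ω.1 (A.history ω t) :=
    Measurable.comp (g := Function.uncurry (stepMean A D f))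
      (f := fun ω : A.Sample N => (ω.1, A.history ω t))
      (measurable_stepMean A D hf) (measurable_fst.prodMk (measurable_history A t))
  have hb := stepMean_mem_Icc A D (fun s h => abs_le.1 (hC s h))
  have i1 : Integrable (fun ω : A.Sample N => f ω.1 (A.history ω (t + 1))) (A.law D) :=
    integrable_of_abs_le hm1 fun _ => hC _ _
  have i2 : Integrable (fun ω : A.Sample N => stepMean A D f ω.1 (A.history ω t)) (A.law D) :=
    integrable_of_abs_le hm2 fun _ => abs_le.2 (hb _ _)
  unfold Policy.law at i1 i2 ⊢
  rw [integral_prod _ i1, integral_prod _ i2]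
  congr 1
  funext s
  have hs : Measurable (f s) := hf.comp (measurable_const.prodMk measurable_id)
  have key := integral_history_succ_of_seed A D s hs (hC s)
  simp only [stepMean] at key ⊢
  exact key

end History

/-! ### Change of measure between two instances -/

theorem mul_log_le_of_pos {q q' x : ℝ} (hq : 0 ≤ q) (hq' : 0 < q') (hx : 0 < x) :
    q * Real.log x ≤ q' * x - 2 * q + q ^ 2 / q' := by
  rcases hq.eq_or_lt with rfl | hq
  · simp; positivity
  have e : Real.log x = Real.log (q' * x / q) + Real.log (q / q') := by
    rw [← Real.log_mul (by positivity) (by positivity)]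
    congr 1
    field_simp
  have h1 := Real.log_le_sub_one_of_pos (show 0 < q' * x / q by positivity)
  have h2 := Real.log_le_sub_one_of_pos (show 0 < q / q' by positivity)
  have h3 : q * Real.log x ≤ q * ((q' * x / q - 1) + (q / q' - 1)) := by
    rw [e]; gcongr
  refine h3.trans (le_of_eq ?_)
  field_simp
  ring

/-- Jensen's inequality for the logarithm under a change of the Bernoulli parameter from `q` to
`q'`; the price of the change is a bound `d` on the `χ²` divergence. -/
theorem mul_log_add_mul_log_le {q q' a b d : ℝ} (hq : q ∈ Icc (0 : ℝ) 1) (ha : 0 < a) (hb : 0 < b)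
    (h : (q' = q ∧ 0 ≤ d) ∨ (0 < q' ∧ q' < 1 ∧ (q - q') ^ 2 ≤ d * (q' * (1 - q')))) :
    q * Real.log a + (1 - q) * Real.log b - d ≤ Real.log (q' * a + (1 - q') * b) := by
  obtain ⟨hq0, hq1⟩ := hq
  rcases h with ⟨rfl, hd⟩ | ⟨h0, h1, hd⟩
  · have := strictConcaveOn_log_Ioi.concaveOn.2 (mem_Ioi.2 ha) (mem_Ioi.2 hb) hq0
      (sub_nonneg.2 hq1) (by ring)
    simp only [smul_eq_mul] at this
    linarith
  · have h1' : 0 < 1 - q' := by linarith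
    have hm : 0 < q' * a + (1 - q') * b := by positivity
    set m := q' * a + (1 - q') * b with hm_def
    have e1 := mul_log_le_of_pos hq0 h0 (div_pos ha hm)
    have e2 := mul_log_le_of_pos (sub_nonneg.2 hq1) h1' (div_pos hb hm)
    rw [Real.log_div ha.ne' hm.ne'] at e1
    rw [Real.log_div hb.ne' hm.ne'] at e2
    have e3 : q' * (a / m) + (1 - q') * (b / m) = 1 := by
      field_simp
      exact hm_def.symm
    have e4 : q ^ 2 / q' + (1 - q) ^ 2 / (1 - q') - 1 ≤ d := by
      have : q ^ 2 / q' + (1 - q) ^ 2 / (1 - q') - 1 = (q - q') ^ 2 / (q' * (1 - q')) := by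
        field_simp
        ring
      rw [this]
      exact div_le_of_le_mul₀ (by positivity) (by nlinarith [sq_nonneg (q - q'), mul_pos h0 h1']) hd
    nlinarith

section Information

variable {N : ℕ} (A : Policy) (D D' : Fin N → ProbabilityMeasure ℝ)

/-- `d` bounds the divergence between the feedback laws of two instances at each price. -/
def DivergenceBound (d : I → ℝ) : Prop :=
  ∀ p, (saleProb D' p = saleProb D p ∧ 0 ≤ d p) ∨
    (0 < saleProb D' p ∧ saleProb D' p < 1 ∧
      (saleProb D p - saleProb D' p) ^ 2 ≤ d p * (saleProb D' p * (1 - saleProb D' p)))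

/-- A variational form of the chain rule for the Kullback–Leibler divergence of the histories
under two instances. -/
theorem one_add_integral_log_sub_le {d : I → ℝ} (hd : Measurable d) {C : ℝ} (hC : ∀ p, |d p| ≤ C)
    (hdiv : DivergenceBound D D' d) {δ : ℝ} (hδ : 0 < δ) (T : ℕ) :
    ∀ G : A.Seed → History T → ℝ, Measurable (Function.uncurry G) →
      (∀ s h, G s h ∈ Icc δ 1) →
      1 + ∫ ω, Real.log (G ω.1 (A.history ω T)) ∂(A.law D)
        - ∑ t ∈ Finset.range T, ∫ ω, d (A.postedPrice ω t) ∂(A.law D)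
      ≤ ∫ ω, G ω.1 (A.history ω T) ∂(A.law D') := by
  have hlogb : ∀ x ∈ Icc δ 1, |Real.log x| ≤ |Real.log δ| := by
    intro x hx
    have h1 : Real.log x ≤ 0 := Real.log_nonpos (hδ.le.trans hx.1) hx.2
    have h2 : Real.log δ ≤ Real.log x := Real.log_le_log hδ hx.1
    rw [abs_of_nonpos h1, abs_of_nonpos (h2.trans h1)]
    linarith
  have hab : ∀ x ∈ Icc δ 1, |x| ≤ 1 := fun x hx => by
    rw [abs_of_nonneg (hδ.le.trans hx.1)]; exact hx.2
  induction T with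
  | zero =>
    intro G hG hGb
    have hs : ∀ E : Fin N → ProbabilityMeasure ℝ, ∀ g : A.Seed → ℝ, Measurable g →
        ∫ ω : A.Sample N, g ω.1 ∂(A.law E) = ∫ s, g s ∂(A.seedLaw : Measure A.Seed) := by
      intro E g hg
      unfold Policy.law
      rw [← integral_map (φ := Prod.fst) measurable_fst.aemeasurable hg.aestronglyMeasurable]
      simp
    have hm : Measurable fun s => G s Fin.elim0 := hG.comp (measurable_id.prodMk measurable_const)
    have e1 := hs D (fun s => Real.log (G s Fin.elim0)) hm.log
    have e2 := hs D' (fun s => G s Fin.elim0) hm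
    simp only [Policy.history, Finset.range_zero, Finset.sum_empty, sub_zero]
    rw [e1, e2]
    have i1 : Integrable (fun s => Real.log (G s Fin.elim0)) (A.seedLaw : Measure A.Seed) :=
      integrable_of_abs_le hm.log fun s => hlogb _ (hGb _ _)
    have i2 : Integrable (fun s => G s Fin.elim0) (A.seedLaw : Measure A.Seed) :=
      integrable_of_abs_le hm fun s => hab _ (hGb _ _)
    have := integral_mono (i1.add (integrable_const (1 : ℝ))) i2 (fun s => by
      have := Real.log_le_sub_one_of_pos (hδ.trans_le (hGb s Fin.elim0).1)
      simp only [Pi.add_apply]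
      linarith)
    simp only [Pi.add_apply] at this
    rw [integral_add i1 (integrable_const _)] at this
    simp only [integral_const, probReal_univ, smul_eq_mul, one_mul] at this
    linarith
  | succ T ih =>
    intro G hG hGb
    rw [integral_history_succ A D' hG fun s h => hab _ (hGb s h),
      integral_history_succ A D hG.log (f := fun s h => Real.log (G s h))
        fun s h => hlogb _ (hGb s h)]
    have hsb := stepMean_mem_Icc A D' hGb
    refine le_trans ?_ (ih (stepMean A D' G) (measurable_stepMean A D' hG) hsb)
    have hpair : Measurable fun ω : A.Sample N => (ω.1, A.history ω T) :=
      measurable_fst.prodMk (measurable_history A T)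
    have i1 : Integrable (fun ω : A.Sample N =>
        stepMean A D (fun s h => Real.log (G s h)) ω.1 (A.history ω T)) (A.law D) :=
      integrable_of_abs_le
        (Measurable.comp (g := Function.uncurry (stepMean A D fun s h => Real.log (G s h)))
          (f := fun ω : A.Sample N => (ω.1, A.history ω T))
          (measurable_stepMean A D (f := fun s h => Real.log (G s h)) hG.log) hpair)
        fun ω => abs_le.2 (stepMean_mem_Icc A D (fun s h => abs_le.1 (hlogb _ (hGb s h))) _ _)
    have i2 : Integrable (fun ω : A.Sample N =>
        Real.log (stepMean A D' G ω.1 (A.history ω T))) (A.law D) :=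
      integrable_of_abs_le
        (Measurable.comp (g := fun x => Real.log (Function.uncurry (stepMean A D' G) x))
          (f := fun ω : A.Sample N => (ω.1, A.history ω T))
          (measurable_stepMean A D' hG).log hpair)
        fun ω => hlogb _ (hsb _ _)
    have i3 : Integrable (fun ω : A.Sample N => d (A.postedPrice ω T)) (A.law D) :=
      integrable_of_abs_le (hd.comp (measurable_postedPrice A T)) fun ω => hC _
    have hmono := integral_mono (i1.sub i3) i2 (fun ω =>
      mul_log_add_mul_log_le (q := saleProb D (A.postedPrice ω T))
        (q' := saleProb D' (A.postedPrice ω T)) (d := d (A.postedPrice ω T))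
        ⟨saleProb_nonneg D _, saleProb_le_one D _⟩
        (hδ.trans_le (hGb ω.1 (extend (A.history ω T) (A.postedPrice ω T) true)).1)
        (hδ.trans_le (hGb ω.1 (extend (A.history ω T) (A.postedPrice ω T) false)).1)
        (hdiv (A.postedPrice ω T)))
    simp only [Pi.sub_apply] at hmono
    rw [integral_sub i1 i3] at hmono
    rw [Finset.sum_range_succ]
    linarith

/-- An event that is rare under `D` is rare under `D'`, up to the information collected. -/
theorem law_real_le_of_divergenceBound {d : I → ℝ} (hd : Measurable d) {C : ℝ}
    (hC : ∀ p, |d p| ≤ C) (hdiv : DivergenceBound D D' d) {T : ℕ}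
    {E : Set (A.Seed × History T)} (hE : MeasurableSet E) :
    (A.law D').real {ω | (ω.1, A.history ω T) ∈ E}
      ≤ 2 * (A.law D).real {ω | (ω.1, A.history ω T) ∈ E}
        + 2 * ∑ t ∈ Finset.range T, ∫ ω, d (A.postedPrice ω t) ∂(A.law D) := by
  classical
  have hpair : Measurable fun ω : A.Sample N => (ω.1, A.history ω T) :=
    measurable_fst.prodMk (measurable_history A T)
  have hE' : MeasurableSet {ω : A.Sample N | (ω.1, A.history ω T) ∈ E} := hpair hE
  have hGm : Measurable fun x => 1 - E.indicator (fun _ => (1 / 2 : ℝ)) x :=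
    measurable_const.sub (measurable_const.indicator hE)
  have key := one_add_integral_log_sub_le A D D' hd hC hdiv (δ := 1 / 2) (by norm_num) T
    (fun s h => 1 - E.indicator (fun _ => (1 / 2 : ℝ)) (s, h)) hGm (fun s h => by
      by_cases hx : (s, h) ∈ E <;> simp [hx] <;> norm_num)
  set S : Set (A.Sample N) := {ω | (ω.1, A.history ω T) ∈ E} with hS
  have e1 : (fun ω : A.Sample N =>
      1 - E.indicator (fun _ => (1 / 2 : ℝ)) (ω.1, A.history ω T))
      = fun ω => 1 - S.indicator (fun _ => (1 / 2 : ℝ)) ω := by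
    funext ω; simp only [hS, indicator, mem_ofPred_eq]
  have e2 : (fun ω : A.Sample N =>
      Real.log (1 - E.indicator (fun _ => (1 / 2 : ℝ)) (ω.1, A.history ω T)))
      = fun ω => S.indicator (fun _ => -Real.log 2) ω := by
    funext ω
    by_cases hx : (ω.1, A.history ω T) ∈ E
    · have hx' : ω ∈ S := hx
      rw [indicator_of_mem hx, indicator_of_mem hx', ← Real.log_inv]
      norm_num
    · have hx' : ω ∉ S := hx
      rw [indicator_of_notMem hx, indicator_of_notMem hx']
      norm_num
  rw [e1, e2, integral_sub (integrable_const _) ((integrable_const _).indicator hE'),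
    integral_indicator_const _ hE', integral_indicator_const _ hE'] at key
  simp only [integral_const, probReal_univ, smul_eq_mul] at key
  have hlog : Real.log 2 ≤ 1 := by linarith [Real.log_two_lt_d9]
  have h0 : 0 ≤ (A.law D).real S := measureReal_nonneg
  nlinarith

end Information

/-! ### Needles in disjoint windows of prices -/

/-- The first `t` rounds of a history. -/
def History.take {T : ℕ} (h : History T) (t : ℕ) (ht : t ≤ T) : History t :=
  fun i => h (Fin.castLE ht i)

theorem History.measurable_take {T t : ℕ} (ht : t ≤ T) :
    Measurable fun h : History T => h.take t ht :=
  measurable_pi_iff.2 fun i => measurable_pi_apply (Fin.castLE ht i)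

theorem history_take {N : ℕ} (A : Policy) (ω : A.Sample N) {T t : ℕ} (ht : t ≤ T) :
    (A.history ω T).take t ht = A.history ω t := by
  induction T with
  | zero =>
    obtain rfl : t = 0 := by omega
    rfl
  | succ T ih =>
    rcases Nat.lt_or_ge T t with h | h
    · obtain rfl : t = T + 1 := by omega
      rfl
    · rw [← ih h]
      funext i
      rw [history_succ]
      have : Fin.castLE ht i = Fin.castSucc (Fin.castLE h i) := rfl
      simp only [History.take, extend, this, Fin.snoc_castSucc]

theorem queries_eq_coe_iff {N : ℕ} (A : PriceFinder) (ω : A.Sample N) (t : ℕ) :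
    A.queries ω = t ↔ A.history ω t ∈ A.halt t ∧ ∀ u < t, A.history ω u ∉ A.halt u := by
  unfold PriceFinder.queries
  constructor
  · intro h
    have hlow : ∀ u < t, A.history ω u ∉ A.halt u := by
      intro u hu hmem
      have h1 : (⨅ (t : ℕ) (_ : A.history ω t ∈ A.halt t), (t : ℕ∞)) ≤ u := iInf₂_le u hmem
      rw [h] at h1
      exact absurd (Nat.cast_le.1 h1) (by omega)
    refine ⟨?_, hlow⟩
    by_contra hn
    have h1 : ((t + 1 : ℕ) : ℕ∞) ≤ ⨅ (t : ℕ) (_ : A.history ω t ∈ A.halt t), (t : ℕ∞) := by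
      refine le_iInf₂ fun u hu => Nat.cast_le.2 ?_
      by_contra hlt
      rcases Nat.lt_or_ge u t with h' | h'
      · exact hlow u h' hu
      · obtain rfl : u = t := by omega
        exact hn hu
    rw [h] at h1
    exact absurd (Nat.cast_le.1 h1) (by omega)
  · rintro ⟨h1, h2⟩
    refine le_antisymm (iInf₂_le t h1) (le_iInf₂ fun u hu => Nat.cast_le.2 ?_)
    by_contra hlt
    exact h2 u (by omega) hu

theorem lt_queries_iff {N : ℕ} (A : PriceFinder) (ω : A.Sample N) (T : ℕ) :
    (T : ℕ∞) < A.queries ω ↔ ∀ u ≤ T, A.history ω u ∉ A.halt u := by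
  constructor
  · intro h u hu hmem
    have h1 : A.queries ω ≤ u := iInf₂_le u hmem
    exact absurd (h.trans_le (h1.trans (Nat.cast_le.2 hu))) (lt_irrefl _)
  · intro h
    have h1 : ((T + 1 : ℕ) : ℕ∞) ≤ A.queries ω := by
      refine le_iInf₂ fun u hu => Nat.cast_le.2 ?_
      by_contra hlt
      exact h u (by omega) hu
    exact lt_of_lt_of_le (Nat.cast_lt.2 (Nat.lt_succ_self T)) h1

/-- The event, read off the seed and the first `T` rounds, that the algorithm has stopped by time
`T` with an output in `W`. -/
def outputEvent (A : PriceFinder) (T : ℕ) (W : Set I) : Set (A.Seed × History T) :=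
  {x | ∃ (t : ℕ) (ht : t ≤ T), x.2.take t ht ∈ A.halt t ∧
    (∀ (u : ℕ) (hu : u < t), x.2.take u (hu.le.trans ht) ∉ A.halt u) ∧
    A.output t x.1 (x.2.take t ht) ∈ W}

theorem measurableSet_outputEvent (A : PriceFinder) (T : ℕ) {W : Set I} (hW : MeasurableSet W) :
    MeasurableSet (outputEvent A T W) := by
  have hm : ∀ (t : ℕ) (ht : t ≤ T),
      Measurable fun x : A.Seed × History T => x.2.take t ht := fun t ht =>
    (History.measurable_take ht).comp measurable_snd
  have heq : outputEvent A T W = ⋃ (t : ℕ) (ht : t ≤ T),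
      ((fun x : A.Seed × History T => x.2.take t ht) ⁻¹' A.halt t ∩
        ⋂ (u : ℕ) (hu : u < t),
          ((fun x : A.Seed × History T => x.2.take u (hu.le.trans ht)) ⁻¹' A.halt u)ᶜ) ∩
        (fun x : A.Seed × History T => A.output t x.1 (x.2.take t ht)) ⁻¹' W := by
    ext x
    simp [outputEvent, and_assoc]
  rw [heq]
  refine MeasurableSet.iUnion fun t => MeasurableSet.iUnion fun ht =>
    ((hm t ht (A.measurableSet_halt t)).inter ?_).inter ?_
  · exact MeasurableSet.iInter fun u => MeasurableSet.iInter fun hu =>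
      (hm u _ (A.measurableSet_halt u)).compl
  · exact ((A.measurable_output t).comp (measurable_fst.prodMk (hm t ht))) hW

theorem mem_outputEvent_iff {N : ℕ} (A : PriceFinder) (ω : A.Sample N) (T : ℕ) (W : Set I) :
    (ω.1, A.history ω T) ∈ outputEvent A T W ↔
      ∃ t ≤ T, A.queries ω = t ∧ A.output t ω.1 (A.history ω t) ∈ W := by
  simp only [outputEvent, mem_ofPred_eq, history_take, queries_eq_coe_iff, and_assoc, exists_prop]

variable {N : ℕ}

/-- Markov's inequality for the number of queries. -/
theorem law_real_lt_queries_le (A : PriceFinder) (D : Fin N → ProbabilityMeasure ℝ) {n : ℝ}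
    (hn : 0 ≤ n) (hq : ∫⁻ ω, (A.queries ω : ℝ≥0∞) ∂(A.law D) ≤ ENNReal.ofReal n) {T : ℕ}
    (hT : 0 < T) :
    (A.law D).real {ω | (T : ℕ∞) < A.queries ω} ≤ n / T := by
  have hm : MeasurableSet {ω : A.Sample N | (T : ℕ∞) < A.queries ω} := by
    simp only [lt_queries_iff, ofPred_forall]
    exact MeasurableSet.iInter fun u => MeasurableSet.iInter fun _ =>
      ((measurable_history A.toPolicy u) (A.measurableSet_halt u)).compl
  have h1 : (T : ℝ≥0∞) * A.law D {ω | (T : ℕ∞) < A.queries ω} ≤ ENNReal.ofReal n := by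
    refine le_trans ?_ hq
    rw [← lintegral_indicator_const hm]
    refine lintegral_mono fun ω => ?_
    by_cases h : ω ∈ {ω : A.Sample N | (T : ℕ∞) < A.queries ω}
    · rw [indicator_of_mem h]
      have h' : (T : ℕ∞) ≤ A.queries ω := le_of_lt h
      calc (T : ℝ≥0∞) = ((T : ℕ∞) : ℝ≥0∞) := by simp
        _ ≤ _ := ENat.toENNReal_le.2 h'
    · rw [indicator_of_notMem h]; exact zero_le
  have h2 := ENNReal.toReal_mono ENNReal.ofReal_ne_top h1
  rw [ENNReal.toReal_mul, ENNReal.toReal_ofReal hn] at h2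
  simp only [ENNReal.toReal_natCast] at h2
  rw [le_div_iff₀ (by positivity), mul_comm]
  exact h2

/-- The lower bound for finding one of `K` needles: each window must be explored enough to tell
the instance `D' j` from the base instance `D`, and the windows are disjoint. -/
theorem card_le_of_solves_needles (A : PriceFinder) {K : ℕ} (D : Fin N → ProbabilityMeasure ℝ)
    (D' : Fin K → Fin N → ProbabilityMeasure ℝ) (W : Fin K → Set I)
    (hW : ∀ j, MeasurableSet (W j)) (hdisj : Pairwise (Function.onFun Disjoint W)) {β : ℝ}
    (hβ : 0 ≤ β)
    (hout : ∀ j, ∀ p ∉ W j, saleProb (D' j) p = saleProb D p)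
    (hin : ∀ j, ∀ p ∈ W j, 0 < saleProb (D' j) p ∧ saleProb (D' j) p < 1 ∧
      (saleProb D p - saleProb (D' j) p) ^ 2
        ≤ β * (saleProb (D' j) p * (1 - saleProb (D' j) p)))
    {ε : ℝ} (hopt : ∀ j p, |revenue (D' j) p - optRevenue (D' j)| ≤ ε → p ∈ W j)
    (hsol : ∀ j, 0.95 ≤ (A.law (D' j)).real (A.success (D' j) ε)) {n : ℝ} (hn : 0 ≤ n)
    (hq : ∀ j, ∫⁻ ω, (A.queries ω : ℝ≥0∞) ∂(A.law (D' j)) ≤ ENNReal.ofReal n) {T : ℕ}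
    (hT : 0 < T) (hnT : 100 * n ≤ T) :
    0.94 * (K : ℝ) ≤ 2 + 2 * β * T := by
  classical
  set E : Fin K → Set (A.Seed × History T) := fun j => outputEvent A T (W j) with hE
  have hEm : ∀ j, MeasurableSet (E j) := fun j => measurableSet_outputEvent A T (hW j)
  have hpair : Measurable fun ω : A.Sample N => (ω.1, A.history ω T) :=
    measurable_fst.prodMk (measurable_history A.toPolicy T)
  set d : Fin K → I → ℝ := fun j => (W j).indicator fun _ => β with hd
  have hdm : ∀ j, Measurable (d j) := fun j => measurable_const.indicator (hW j)
  have hdb : ∀ j p, |d j p| ≤ β := fun j p => by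
    by_cases h : p ∈ W j <;> simp [hd, h, abs_of_nonneg hβ, hβ]
  have hdiv : ∀ j, DivergenceBound D (D' j) (d j) := fun j p => by
    by_cases h : p ∈ W j
    · right; simpa [hd, h] using hin j p h
    · left; exact ⟨hout j p h, by simp [hd, h]⟩
  have hlow : ∀ j, 0.94 ≤ (A.law (D' j)).real {ω | (ω.1, A.history ω T) ∈ E j} := by
    intro j
    have hsub : A.success (D' j) ε ⊆
        {ω | (ω.1, A.history ω T) ∈ E j} ∪ {ω | (T : ℕ∞) < A.queries ω} := by
      rintro ω ⟨t, ht, hrev⟩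
      rcases Nat.lt_or_ge T t with h | h
      · right
        show (T : ℕ∞) < A.queries ω
        rw [ht]; exact Nat.cast_lt.2 h
      · left
        exact (mem_outputEvent_iff A ω T (W j)).2 ⟨t, h, ht, hopt j _ hrev⟩
    have h1 := (hsol j).trans ((measureReal_mono hsub).trans (measureReal_union_le _ _))
    have h2 := law_real_lt_queries_le A (D' j) hn (hq j) hT
    have h3 : n / T ≤ 0.01 := by
      rw [div_le_iff₀ (by positivity)]; linarith
    norm_num at h1 h3 ⊢
    linarith
  have hup := fun j => law_real_le_of_divergenceBound A.toPolicy D (D' j) (hdm j) (hdb j) (hdiv j)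
    (hEm j)
  have hsum0 : ∑ j, (A.law D).real {ω | (ω.1, A.history ω T) ∈ E j} ≤ 1 := by
    have hdj : Pairwise (Function.onFun Disjoint
        fun j => {ω : A.Sample N | (ω.1, A.history ω T) ∈ E j}) := by
      intro i j hij
      refine Set.disjoint_left.2 fun ω hi hj => ?_
      obtain ⟨t, -, ht, hti⟩ := (mem_outputEvent_iff A ω T (W i)).1 hi
      obtain ⟨u, -, hu, huj⟩ := (mem_outputEvent_iff A ω T (W j)).1 hj
      obtain rfl : t = u := by
        have := ht.symm.trans hu
        exact_mod_cast this
      exact Set.disjoint_left.1 (hdisj hij) hti huj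
    rw [← measureReal_iUnion_fintype hdj fun j => hpair (hEm j)]
    exact measureReal_le_one
  have hsum1 : ∑ j, ∑ t ∈ Finset.range T, ∫ ω, d j (A.postedPrice ω t) ∂(A.law D) ≤ β * T := by
    rw [Finset.sum_comm]
    have : ∀ t ∈ Finset.range T, ∑ j, ∫ ω, d j (A.postedPrice ω t) ∂(A.law D) ≤ β := by
      intro t _
      have hi : ∀ j, Integrable (fun ω : A.Sample N => d j (A.postedPrice ω t)) (A.law D) :=
        fun j => integrable_of_abs_le ((hdm j).comp (measurable_postedPrice A.toPolicy t))
          fun ω => hdb j _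
      rw [← integral_finsetSum _ fun j _ => hi j]
      have hp : ∀ p : I, ∑ j, d j p ≤ β := by
        intro p
        by_cases h : ∃ j, p ∈ W j
        · obtain ⟨j, hj⟩ := h
          rw [Finset.sum_eq_single j]
          · simp [hd, hj]
          · intro i _ hij
            have : p ∉ W i := fun hi => Set.disjoint_left.1 (hdisj hij) hi hj
            simp [hd, this]
          · simp
        · push Not at h
          simp [hd, h, hβ]
      calc _ ≤ ∫ _, β ∂(A.law D) := integral_mono (integrable_finsetSum _ fun j _ => hi j)
            (integrable_const _) fun ω => hp _
        _ = β := by simp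
    calc _ ≤ ∑ t ∈ Finset.range T, β := Finset.sum_le_sum this
      _ = β * T := by simp [mul_comm]
  have hK : 0.94 * (K : ℝ) = ∑ _j : Fin K, (0.94 : ℝ) := by simp [mul_comm]
  rw [hK]
  calc _ ≤ ∑ j, (2 * (A.law D).real {ω | (ω.1, A.history ω T) ∈ E j}
        + 2 * ∑ t ∈ Finset.range T, ∫ ω, d j (A.postedPrice ω t) ∂(A.law D)) :=
        Finset.sum_le_sum fun j _ => (hlow j).trans (hup j)
    _ ≤ 2 + 2 * β * T := by
        rw [Finset.sum_add_distrib, ← Finset.mul_sum, ← Finset.mul_sum]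
        linarith

/-! ### From regret to query complexity -/

open Classical in
theorem history_apply {N : ℕ} (A : Policy) (ω : A.Sample N) {T : ℕ} (i : Fin T) :
    A.history ω T i = (A.postedPrice ω i,
      decide (∃ k, (A.postedPrice ω i : ℝ) ≤ ω.2 i k)) := by
  have h1 : A.history ω T i = (A.history ω T).take (i + 1) i.2 (Fin.last i) := rfl
  rw [h1, history_take, history_succ, extend, Fin.snoc_last]

/-- The algorithm that runs a policy for `T` rounds and outputs one of the `T` posted prices,
chosen uniformly at random. -/
def uniformStop (A : Policy) (T : ℕ) [NeZero T] : PriceFinder where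
  Seed := A.Seed × Fin T
  seedLaw := ⟨(A.seedLaw : Measure A.Seed).prod (PMF.uniformOfFintype (Fin T)).toMeasure,
    inferInstance⟩
  price t s h := A.price t s.1 h
  measurable_price t := (A.measurable_price t).comp
    ((measurable_fst.comp measurable_fst).prodMk measurable_snd)
  halt t := {_h | t = T}
  measurableSet_halt t := MeasurableSet.const _
  output t s h := if ht : (s.2 : ℕ) < t then (h ⟨s.2, ht⟩).1 else 0
  measurable_output t := by
    have h1 : Measurable fun x : Fin T × History t =>
        if ht : (x.1 : ℕ) < t then (x.2 ⟨x.1, ht⟩).1 else (0 : I) := by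
      refine measurable_from_prod_countable_right fun k => ?_
      by_cases hk : (k : ℕ) < t
      · simp only [hk, dite_true]
        exact measurable_fst.comp (measurable_pi_apply (⟨k, hk⟩ : Fin t))
      · simp only [hk, dite_false]
        exact measurable_const
    exact h1.comp ((measurable_snd.comp measurable_fst).prodMk measurable_snd)

variable {N : ℕ} (A : Policy) (T : ℕ) [NeZero T]

theorem uniformStop_history (ω : (uniformStop A T).Sample N) (t : ℕ) :
    (uniformStop A T).history ω t = A.history (ω.1.1, ω.2) t := by
  induction t with
  | zero => rfl
  | succ t ih =>
    have hp : (uniformStop A T).postedPrice ω t = A.postedPrice (ω.1.1, ω.2) t := by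
      simp only [Policy.postedPrice, ih]
      rfl
    rw [history_succ, history_succ, ih, hp]

theorem uniformStop_queries (ω : (uniformStop A T).Sample N) :
    (uniformStop A T).queries ω = T :=
  (queries_eq_coe_iff _ ω T).2 ⟨rfl, fun _ hu => hu.ne⟩

theorem uniformStop_output (ω : (uniformStop A T).Sample N) :
    (uniformStop A T).output T ω.1 ((uniformStop A T).history ω T)
      = A.postedPrice (ω.1.1, ω.2) ω.1.2 := by
  rw [uniformStop_history]
  have : (uniformStop A T).output T ω.1 (A.history (ω.1.1, ω.2) T)
      = (A.history (ω.1.1, ω.2) T ω.1.2).1 := dif_pos ω.1.2.2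
  rw [this, history_apply]

theorem integral_uniformStop (D : Fin N → ProbabilityMeasure ℝ) (g : I → ℝ) (hg : Measurable g)
    {C : ℝ} (hC : ∀ p, |g p| ≤ C) :
    ∫ ω : (uniformStop A T).Sample N, g (A.postedPrice (ω.1.1, ω.2) ω.1.2)
        ∂((uniformStop A T).law D)
      = (T : ℝ)⁻¹ * ∑ t ∈ Finset.range T, ∫ ω, g (A.postedPrice ω t) ∂(A.law D) := by
  have hm : ∀ t, Measurable fun ω : A.Sample N => g (A.postedPrice ω t) := fun t =>
    hg.comp (measurable_postedPrice A t)
  have hm' : Measurable fun ω : (A.Seed × Fin T) × (ℕ → Fin N → ℝ) =>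
      g (A.postedPrice (ω.1.1, ω.2) ω.1.2) := by
    have : Measurable fun x : Fin T × A.Sample N => g (A.postedPrice x.2 x.1) :=
      measurable_from_prod_countable_right fun k => hm k
    exact this.comp ((measurable_snd.comp measurable_fst).prodMk
      ((measurable_fst.comp measurable_fst).prodMk measurable_snd))
  set μ : Measure A.Seed := (A.seedLaw : Measure A.Seed)
  set ν : Measure (ℕ → Fin N → ℝ) := Measure.infinitePi fun _ : ℕ => roundLaw D
  set u : Measure (Fin T) := (PMF.uniformOfFintype (Fin T)).toMeasure
  have e1 : ∫ ω : (uniformStop A T).Sample N, g (A.postedPrice (ω.1.1, ω.2) ω.1.2)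
        ∂((uniformStop A T).law D)
      = ∫ ω : (A.Seed × Fin T) × (ℕ → Fin N → ℝ), g (A.postedPrice (ω.1.1, ω.2) ω.1.2)
        ∂((μ.prod u).prod ν) := rfl
  have i1 : Integrable (fun ω : (A.Seed × Fin T) × (ℕ → Fin N → ℝ) =>
      g (A.postedPrice (ω.1.1, ω.2) ω.1.2)) ((μ.prod u).prod ν) :=
    integrable_of_abs_le hm' fun _ => hC _
  have i2 : ∀ t, Integrable (fun ω : A.Sample N => g (A.postedPrice ω t)) (μ.prod ν) := fun t =>
    integrable_of_abs_le (hm t) fun _ => hC _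
  rw [e1, integral_prod _ i1, integral_prod _ i1.integral_prod_left]
  have e2 : ∀ s : A.Seed, ∫ k, ∫ b, g (A.postedPrice (s, b) k) ∂ν ∂u
      = ∑ k : Fin T, (T : ℝ)⁻¹ * ∫ b, g (A.postedPrice (s, b) k) ∂ν := by
    intro s
    rw [PMF.integral_eq_sum]
    refine Finset.sum_congr rfl fun k _ => ?_
    simp [PMF.uniformOfFintype_apply]
  simp only [e2]
  have e3 : ∀ k : Fin T, Integrable
      (fun s => (T : ℝ)⁻¹ * ∫ b, g (A.postedPrice (s, b) k) ∂ν) μ := fun k =>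
    (i2 k).integral_prod_left.const_mul _
  rw [integral_finsetSum _ fun k _ => e3 k, Finset.mul_sum, ← Fin.sum_univ_eq_sum_range
      (fun t => (T : ℝ)⁻¹ * ∫ ω, g (A.postedPrice ω t) ∂(A.law D))]
  refine Finset.sum_congr rfl fun k _ => ?_
  rw [integral_const_mul]
  congr 1
  exact (integral_prod _ (i2 k)).symm

theorem abs_revenue_le_one (D : Fin N → ProbabilityMeasure ℝ) (p : I) : |revenue D p| ≤ 1 :=
  abs_le.2 ⟨by linarith [revenue_nonneg D p], revenue_le_one D p⟩

theorem optRevenue_le_one (D : Fin N → ProbabilityMeasure ℝ) : optRevenue D ≤ 1 :=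
  ciSup_le fun p => revenue_le_one D p

/-- Online-to-batch conversion, by Markov's inequality for the loss of a random posted price. -/
theorem uniformStop_success (D : Fin N → ProbabilityMeasure ℝ) {ε : ℝ} (hε : 0 < ε)
    (h : A.regret D T ≤ 0.05 * T * ε) :
    0.95 ≤ ((uniformStop A T).law D).real ((uniformStop A T).success D ε) := by
  have hT : (0 : ℝ) < T := by exact_mod_cast Nat.pos_of_ne_zero (NeZero.ne T)
  set gap : I → ℝ := fun p => optRevenue D - revenue D p with hgap
  have hg : Measurable gap := measurable_const.sub (measurable_revenue D)
  have hg0 : ∀ p, 0 ≤ gap p := fun p => sub_nonneg.2 (revenue_le_optRevenue D p)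
  have hg1 : ∀ p, |gap p| ≤ 1 := fun p => by
    rw [abs_of_nonneg (hg0 p)]
    linarith [optRevenue_le_one D, revenue_nonneg D p, hgap]
  have hreg : A.regret D T = ∑ t ∈ Finset.range T, ∫ ω, gap (A.postedPrice ω t) ∂(A.law D) := by
    have hi : ∀ t, Integrable (fun ω : A.Sample N => revenue D (A.postedPrice ω t)) (A.law D) :=
      fun t => integrable_of_abs_le ((measurable_revenue D).comp (measurable_postedPrice A t))
        fun _ => abs_revenue_le_one D _
    rw [Policy.regret, integral_finsetSum _ fun t _ => hi t]
    simp only [hgap]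
    have : ∀ t, ∫ ω, (optRevenue D - revenue D (A.postedPrice ω t)) ∂(A.law D)
        = optRevenue D - ∫ ω, revenue D (A.postedPrice ω t) ∂(A.law D) := fun t => by
      rw [integral_sub (integrable_const _) (hi t)]
      simp
    simp [this]
  set X : (uniformStop A T).Sample N → ℝ := fun ω => gap (A.postedPrice (ω.1.1, ω.2) ω.1.2)
    with hX
  have hXm : Measurable X := by
    have : Measurable fun x : Fin T × A.Sample N => gap (A.postedPrice x.2 x.1) :=
      measurable_from_prod_countable_right fun k => hg.comp (measurable_postedPrice A k)
    exact this.comp ((measurable_snd.comp measurable_fst).prodMk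
      ((measurable_fst.comp measurable_fst).prodMk measurable_snd))
  have hint : ∫ ω, X ω ∂((uniformStop A T).law D) ≤ 0.05 * ε := by
    have e := integral_uniformStop A T D gap hg hg1
    rw [← hreg] at e
    rw [hX, e, inv_mul_le_iff₀ hT]
    linarith
  have hsucc : {ω | ε ≤ X ω}ᶜ ⊆ (uniformStop A T).success D ε := by
    intro ω hω
    refine ⟨T, uniformStop_queries A T ω, ?_⟩
    rw [uniformStop_output, abs_sub_comm, abs_of_nonneg (hg0 _)]
    exact le_of_not_ge hω
  have hmark := mul_meas_ge_le_integral_of_nonneg (μ := (uniformStop A T).law D) (f := X)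
    (ae_of_all _ fun ω => hg0 _)
    (integrable_of_abs_le hXm fun ω => hg1 _) ε
  have hbad : ((uniformStop A T).law D).real {ω | ε ≤ X ω} ≤ 0.05 := by
    have : ε * ((uniformStop A T).law D).real {ω | ε ≤ X ω} ≤ ε * 0.05 := by linarith
    exact le_of_mul_le_mul_left this hε
  have hcompl := probReal_compl_eq_one_sub (μ := (uniformStop A T).law D)
    (measurableSet_le (measurable_const (a := ε)) hXm)
  have := measureReal_mono (μ := (uniformStop A T).law D) hsucc
  norm_num at hbad ⊢
  linarith

theorem queryComplexity_le_sureQueryComplexity (𝓓 : Set (ProbabilityMeasure ℝ)) (N : ℕ) (ε : ℝ) :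
    queryComplexity 𝓓 N ε ≤ sureQueryComplexity 𝓓 N ε := by
  refine iInf₂_mono fun A _ => iSup₂_le fun D _ => ?_
  calc _ ≤ ∫⁻ _, (⨆ ω : A.Sample N, (A.queries ω : ℝ≥0∞)) ∂(A.law D) :=
        lintegral_mono fun ω => le_iSup (fun ω : A.Sample N => (A.queries ω : ℝ≥0∞)) ω
    _ = _ := by simp

/-- A policy with small regret over `T` rounds yields an algorithm with `T` queries. -/
theorem sureQueryComplexity_le_of_regret_le (𝓓 : Set (ProbabilityMeasure ℝ)) {ε : ℝ} (hε : 0 < ε)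
    (h : ∀ D ∈ Instances 𝓓 N, A.regret D T ≤ 0.05 * T * ε) :
    sureQueryComplexity 𝓓 N ε ≤ T := by
  refine iInf₂_le_of_le (uniformStop A T) (fun D hD => uniformStop_success A T D hε (h D hD)) ?_
  refine iSup_le fun ω => ?_
  rw [uniformStop_queries]
  simp

/-! ### Randomized policies on finitely many prices -/

/-- Every law on finitely many arms is the law of a function of a uniform random variable. -/
theorem exists_sampler {K : ℕ} (w : Fin K → ℝ) (hw : ∀ i, 0 ≤ w i) (hsum : ∑ i, w i = 1) :
    ∃ a : I → Fin K, Measurable a ∧ ∀ g : Fin K → ℝ, ∫ u, g (a u) = ∑ i, w i * g i := by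
  have hp : ∑ i, ENNReal.ofReal (w i) = 1 := by
    rw [← ENNReal.ofReal_sum_of_nonneg fun i _ => hw i, hsum, ENNReal.ofReal_one]
  set P := PMF.ofFintype (fun i => ENNReal.ofReal (w i)) hp with hP
  have hne : Nonempty (Fin K) := P.support_nonempty.nonempty
  obtain ⟨a, ha, hmap⟩ := P.toMeasure.exists_measurable_map_eq
  refine ⟨a, ha, fun g => ?_⟩
  rw [← integral_map (f := g) ha.aemeasurable (measurable_of_finite g).aestronglyMeasurable, hmap,
    PMF.integral_eq_sum]
  refine Finset.sum_congr rfl fun i _ => ?_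
  simp [hP, PMF.ofFintype_apply, ENNReal.toReal_ofReal (hw i)]

/-- The rounds played so far on `K` arms: which arm was pulled, with which feedback. -/
abbrev ArmHistory (K t : ℕ) : Type := Fin t → Fin K × Bool

section Arms

variable {K : ℕ} [NeZero K] (x : Fin K → I)

/-- The history in terms of arms, when arm `i` is the price `x i`. -/
def armHistory {t : ℕ} (h : History t) : ArmHistory K t :=
  fun k => (Function.invFun x (h k).1, (h k).2)

theorem measurable_invFun_price : Measurable (Function.invFun x) := by
  refine (measurable_const (a := Classical.choice ⟨(0 : Fin K)⟩)).measurable_of_countable_ne ?_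
  refine (countable_range x).mono fun p hp => ?_
  by_contra hn
  exact hp (Function.invFun_neg fun ⟨i, hi⟩ => hn ⟨i, hi⟩).symm

theorem measurable_armHistory (t : ℕ) :
    Measurable fun h : History t => armHistory x h :=
  measurable_pi_iff.2 fun k =>
    ((measurable_invFun_price x).comp (measurable_fst.comp (measurable_pi_apply k))).prodMk
      (measurable_snd.comp (measurable_pi_apply k))

variable {x} in
theorem armHistory_extend (hx : Function.Injective x) {t : ℕ} (h : History t) (i : Fin K)
    (z : Bool) :
    armHistory x (extend h (x i) z)
      = Fin.snoc (α := fun _ => Fin K × Bool) (armHistory x h) (i, z) := by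
  funext k
  refine Fin.lastCases ?_ (fun j => ?_) k
  · simp [armHistory, extend, Function.leftInverse_invFun hx i]
  · simp [armHistory, extend]

/-- The policy that in round `t` pulls the arm that the sampler `a t` picks, given the rounds
played so far, from a fresh uniform random variable. -/
def samplerPolicy (a : ∀ t, ArmHistory K t → I → Fin K) (ha : ∀ t e, Measurable (a t e)) :
    Policy where
  Seed := ℕ → I
  seedLaw := ⟨Measure.infinitePi fun _ => volume, inferInstance⟩
  price t s h := x (a t (armHistory x h) (s t))
  measurable_price t := by
    have h1 : Measurable fun y : ArmHistory K t × I => x (a t y.1 y.2) :=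
      measurable_from_prod_countable_right fun e => (measurable_of_finite x).comp (ha t e)
    exact h1.comp (((measurable_armHistory x t).comp measurable_snd).prodMk
      ((measurable_pi_apply t).comp measurable_fst))

variable (a : ∀ t, ArmHistory K t → I → Fin K) (ha : ∀ t e, Measurable (a t e))

/-- The arms pulled in the first `t` rounds, with the feedbacks. -/
def pulls {N : ℕ} (ω : (samplerPolicy x a ha).Sample N) (t : ℕ) : ArmHistory K t :=
  armHistory x ((samplerPolicy x a ha).history ω t)

theorem measurable_pulls {N : ℕ} (t : ℕ) :
    Measurable fun ω : (samplerPolicy x a ha).Sample N => pulls x a ha ω t :=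
  (measurable_armHistory x t).comp (measurable_history _ t)

theorem samplerPolicy_history_update {N : ℕ} (s : ℕ → I) (b : ℕ → Fin N → ℝ) {t u : ℕ}
    (htu : t ≤ u) (y : I) :
    (samplerPolicy x a ha).history (Function.update s u y, b) t
      = (samplerPolicy x a ha).history (s, b) t := by
  induction t with
  | zero => rfl
  | succ t ih =>
    have h := ih (by omega)
    have hs : Function.update s u y t = s t := Function.update_of_ne (by omega) _ _
    have hp : (samplerPolicy x a ha).postedPrice (Function.update s u y, b) t
        = (samplerPolicy x a ha).postedPrice (s, b) t := by
      simp only [Policy.postedPrice, h]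
      simp only [samplerPolicy, hs]
    rw [history_succ, history_succ, h, hp]

variable {N : ℕ} (D : Fin N → ProbabilityMeasure ℝ)

variable {a} in
/-- Given the past, the arm of round `t` has the law that the sampler is meant to have. -/
theorem integral_samplerPolicy_price (w : ∀ t, ArmHistory K t → Fin K → ℝ)
    (haw : ∀ t e (g : Fin K → ℝ), ∫ u, g (a t e u) = ∑ i, w t e i * g i) (t : ℕ)
    (g : ArmHistory K t → I → ℝ) (hg : ∀ e, Measurable (g e)) {C : ℝ} (hC : ∀ e p, |g e p| ≤ C) :
    ∫ ω, g (pulls x a ha ω t) ((samplerPolicy x a ha).postedPrice ω t)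
        ∂((samplerPolicy x a ha).law D)
      = ∫ ω, ∑ i, w t (pulls x a ha ω t) i * g (pulls x a ha ω t) (x i)
        ∂((samplerPolicy x a ha).law D) := by
  set A := samplerPolicy x a ha with hA
  have hpm := measurable_pulls x a ha (N := N) t
  have hgu : Measurable fun y : ArmHistory K t × I => g y.1 y.2 :=
    measurable_from_prod_countable_right hg
  have hF : Measurable fun y : ArmHistory K t × I => g y.1 (x (a t y.1 y.2)) :=
    measurable_from_prod_countable_right fun e =>
      (hg e).comp ((measurable_of_finite x).comp (ha t e))
  have hS : Measurable fun e : ArmHistory K t => ∑ i, w t e i * g e (x i) :=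
    measurable_of_countable _
  have hSe : ∀ e, ∑ i, w t e i * g e (x i) = ∫ u, g e (x (a t e u)) := fun e =>
    (haw t e fun i => g e (x i)).symm
  have hSb : ∀ e, |∑ i, w t e i * g e (x i)| ≤ C := fun e => by
    rw [hSe]
    have := norm_integral_le_of_norm_le_const (μ := (volume : Measure I)) (C := C)
      (f := fun u => g e (x (a t e u))) (ae_of_all _ fun u => hC _ _)
    simpa using this
  set ρ : Measure (ℕ → I) := Measure.infinitePi fun _ => volume
  set ν : Measure (ℕ → Fin N → ℝ) := Measure.infinitePi fun _ : ℕ => roundLaw D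
  have i1 : Integrable (fun ω : (ℕ → I) × (ℕ → Fin N → ℝ) =>
      g (pulls x a ha ω t) (A.postedPrice ω t)) (ρ.prod ν) :=
    integrable_of_abs_le (hgu.comp (hpm.prodMk (measurable_postedPrice A t))) fun _ => hC _ _
  have i2 : Integrable (fun ω : (ℕ → I) × (ℕ → Fin N → ℝ) =>
      ∑ i, w t (pulls x a ha ω t) i * g (pulls x a ha ω t) (x i)) (ρ.prod ν) :=
    integrable_of_abs_le (hS.comp hpm) fun _ => hSb _
  have key : ∫ ω : (ℕ → I) × (ℕ → Fin N → ℝ), g (pulls x a ha ω t) (A.postedPrice ω t)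
        ∂(ρ.prod ν)
      = ∫ ω : (ℕ → I) × (ℕ → Fin N → ℝ),
        ∑ i, w t (pulls x a ha ω t) i * g (pulls x a ha ω t) (x i) ∂(ρ.prod ν) := by
    rw [integral_prod_symm _ i1, integral_prod_symm _ i2]
    congr 1
    funext b
    have hb : Measurable fun s : ℕ → I => pulls x a ha (s, b) t :=
      hpm.comp (measurable_id.prodMk measurable_const)
    have := integral_infinitePi_resample (volume : Measure I) t
      (fun s u => g (pulls x a ha (s, b) t) (x (a t (pulls x a ha (s, b) t) u)))
      (hF.comp ((hb.comp measurable_fst).prodMk measurable_snd)) (C := C) (fun _ _ => hC _ _)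
      (fun s u y => by
        simp only [pulls, samplerPolicy_history_update x a ha s b le_rfl])
    simp only [hSe]
    exact this
  exact key

variable {a} {x} in
/-- The law of the next round, given the past, when arms are drawn with weights `w`. -/
theorem integral_pulls_succ (hx : Function.Injective x) (w : ∀ t, ArmHistory K t → Fin K → ℝ)
    (haw : ∀ t e (g : Fin K → ℝ), ∫ u, g (a t e u) = ∑ i, w t e i * g i) (t : ℕ)
    (g : ArmHistory K (t + 1) → ℝ) :
    ∫ ω, g (pulls x a ha ω (t + 1)) ∂((samplerPolicy x a ha).law D)
      = ∫ ω, ∑ i, w t (pulls x a ha ω t) i *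
          (saleProb D (x i) *
              g (Fin.snoc (α := fun _ => Fin K × Bool) (pulls x a ha ω t) (i, true))
            + (1 - saleProb D (x i)) *
              g (Fin.snoc (α := fun _ => Fin K × Bool) (pulls x a ha ω t) (i, false)))
        ∂((samplerPolicy x a ha).law D) := by
  obtain ⟨C, hC⟩ : ∃ C, ∀ e, |g e| ≤ C := by
    obtain ⟨C, hC⟩ := (finite_range fun e => |g e|).bddAbove
    exact ⟨C, fun e => hC ⟨e, rfl⟩⟩
  have hgm : Measurable fun h : History (t + 1) => g (armHistory x h) :=
    (measurable_of_countable g).comp (measurable_armHistory x (t + 1))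
  set A := samplerPolicy x a ha with hA
  have h1 := integral_history_succ A D (t := t) (f := fun _ h => g (armHistory x h))
    (hgm.comp measurable_snd) (C := C) fun _ _ => hC _
  set ψ : ArmHistory K t → I → ℝ := fun e p =>
    saleProb D p * g (Fin.snoc (α := fun _ => Fin K × Bool) e (Function.invFun x p, true))
      + (1 - saleProb D p) *
        g (Fin.snoc (α := fun _ => Fin K × Bool) e (Function.invFun x p, false)) with hψ
  have hψm : ∀ e, Measurable (ψ e) := by
    intro e
    have hz : ∀ z : Bool, Measurable fun p =>
        g (Fin.snoc (α := fun _ => Fin K × Bool) e (Function.invFun x p, z)) := fun z =>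
      (measurable_of_finite fun i : Fin K =>
        g (Fin.snoc (α := fun _ => Fin K × Bool) e (i, z))).comp (measurable_invFun_price x)
    exact ((measurable_saleProb D).mul (hz true)).add
      ((measurable_const.sub (measurable_saleProb D)).mul (hz false))
  have hψb : ∀ e p, |ψ e p| ≤ C := by
    intro e p
    have q0 := saleProb_nonneg D p
    have q1 := saleProb_le_one D p
    have b1 := abs_le.1 (hC (Fin.snoc (α := fun _ => Fin K × Bool) e (Function.invFun x p, true)))
    have b2 := abs_le.1 (hC (Fin.snoc (α := fun _ => Fin K × Bool) e (Function.invFun x p, false)))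
    rw [abs_le]
    constructor <;> simp only [hψ] <;> nlinarith
  have h2 := integral_samplerPolicy_price x ha D w haw t ψ hψm hψb
  simp only [hψ, Function.leftInverse_invFun hx _] at h2
  refine h1.trans (Eq.trans ?_ h2)
  congr 1
  funext ω
  have he : ∀ z, armHistory x (extend (A.history ω t) (A.postedPrice ω t) z)
      = Fin.snoc (α := fun _ => Fin K × Bool) (pulls x a ha ω t)
        (Function.invFun x (A.postedPrice ω t), z) := by
    intro z
    have hp : x (Function.invFun x (A.postedPrice ω t)) = A.postedPrice ω t :=
      Function.invFun_eq ⟨_, rfl⟩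
    have := armHistory_extend hx (A.history ω t) (Function.invFun x (A.postedPrice ω t)) z
    rw [hp] at this
    exact this
  show saleProb D (A.postedPrice ω t) * g (armHistory x (extend (A.history ω t)
      (A.postedPrice ω t) true)) + (1 - saleProb D (A.postedPrice ω t)) *
      g (armHistory x (extend (A.history ω t) (A.postedPrice ω t) false)) = _
  rw [he, he]

end Arms

/-! ### The Tsallis-entropy forecaster -/

section Forecaster

variable {K : ℕ} [NeZero K] {η : ℝ}

/-- The Lagrange multiplier that normalizes the weights of the forecaster exists. -/
theorem exists_normalizer (hη : 0 < η) (L : Fin K → ℝ) :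
    ∃ y, (∀ i, y < L i) ∧ ∑ i, 1 / (η * (L i - y)) ^ 2 = 1 := by
  have hK : (1 : ℝ) ≤ K := by exact_mod_cast Nat.one_le_iff_ne_zero.2 (NeZero.ne K)
  obtain ⟨i₀, hi₀⟩ := Finite.exists_min L
  set m := L i₀ with hm
  set y₁ := m - √K / η with hy₁
  set y₂ := m - 1 / η with hy₂
  have hs : 1 ≤ √(K : ℝ) := Real.one_le_sqrt.2 hK
  have h12 : y₁ ≤ y₂ := by
    rw [hy₁, hy₂]; gcongr
  have hlt : ∀ y ≤ y₂, ∀ i, 1 / η ≤ L i - y := by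
    intro y hy i
    linarith [hi₀ i]
  have hη' : 0 < 1 / η := by positivity
  have hcont : ContinuousOn (fun y => ∑ i, 1 / (η * (L i - y)) ^ 2) (Icc y₁ y₂) := by
    refine continuousOn_finsetSum _ fun i _ => ?_
    refine ContinuousOn.div continuousOn_const (by fun_prop) fun y hy => ?_
    have : 0 < L i - y := hη'.trans_le (hlt y hy.2 i)
    positivity
  have hv₁ : ∑ i, 1 / (η * (L i - y₁)) ^ 2 ≤ 1 := by
    have : ∀ i ∈ Finset.univ, 1 / (η * (L i - y₁)) ^ 2 ≤ 1 / (K : ℝ) := by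
      intro i _
      have h1 : √K ≤ η * (L i - y₁) := by
        have : √K / η ≤ L i - y₁ := by linarith [hi₀ i]
        rwa [div_le_iff₀' hη] at this
      have h2 : (K : ℝ) ≤ (η * (L i - y₁)) ^ 2 := by
        calc (K : ℝ) = √K ^ 2 := (Real.sq_sqrt (by positivity)).symm
          _ ≤ _ := by gcongr
      gcongr
    calc _ ≤ ∑ _i : Fin K, 1 / (K : ℝ) := Finset.sum_le_sum this
      _ = 1 := by
        simp only [Finset.sum_const, Finset.card_univ, Fintype.card_fin, nsmul_eq_mul]
        field_simp
  have hv₂ : 1 ≤ ∑ i, 1 / (η * (L i - y₂)) ^ 2 := by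
    have h1 : 1 / (η * (L i₀ - y₂)) ^ 2 = 1 := by
      have : L i₀ - y₂ = 1 / η := by rw [hy₂, hm]; ring
      rw [this]
      field_simp
    refine h1.symm.le.trans ?_
    exact Finset.single_le_sum (f := fun i => 1 / (η * (L i - y₂)) ^ 2)
      (fun i _ => by positivity) (Finset.mem_univ i₀)
  obtain ⟨y, hy, hy'⟩ := intermediate_value_Icc h12 hcont ⟨hv₁, hv₂⟩
  exact ⟨y, fun i => by linarith [hlt y hy.2 i], hy'⟩

/-- The normalizer of the weights at cumulative losses `L`, for the learning rate `η`. -/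
def normalizer (hη : 0 < η) (L : Fin K → ℝ) : ℝ := (exists_normalizer hη L).choose

theorem normalizer_lt (hη : 0 < η) (L : Fin K → ℝ) (i : Fin K) : normalizer hη L < L i :=
  (exists_normalizer hη L).choose_spec.1 i

/-- The probability with which the forecaster pulls arm `i` at cumulative losses `L`: the minimizer
over the simplex of `⟨w, L⟩ - (2/η) ∑ √w_i`. -/
def weight (hη : 0 < η) (L : Fin K → ℝ) (i : Fin K) : ℝ :=
  1 / (η * (L i - normalizer hη L)) ^ 2

theorem weight_pos (hη : 0 < η) (L : Fin K → ℝ) (i : Fin K) : 0 < weight hη L i := by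
  have := sub_pos.2 (normalizer_lt hη L i)
  unfold weight
  positivity

theorem sum_weight (hη : 0 < η) (L : Fin K → ℝ) : ∑ i, weight hη L i = 1 :=
  (exists_normalizer hη L).choose_spec.2

theorem sqrt_weight (hη : 0 < η) (L : Fin K → ℝ) (i : Fin K) :
    √(weight hη L i) = 1 / (η * (L i - normalizer hη L)) := by
  have := sub_pos.2 (normalizer_lt hη L i)
  rw [weight, Real.sqrt_div zero_le_one, Real.sqrt_one, Real.sqrt_sq (by positivity)]

theorem sum_sqrt_weight_le (hη : 0 < η) (L : Fin K → ℝ) : ∑ i, √(weight hη L i) ≤ √K := by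
  refine Real.le_sqrt_of_sq_le ?_
  have := sq_sum_le_card_mul_sum_sq (s := Finset.univ) (f := fun i => √(weight hη L i))
  simp only [Real.sq_sqrt (weight_pos hη L _).le, sum_weight, Finset.card_univ, Fintype.card_fin,
    mul_one] at this
  exact this

/-- The Lagrangian dual of the minimization problem that defines the weights. -/
def dualObjective (η : ℝ) (L : Fin K → ℝ) (y : ℝ) : ℝ := y - ∑ i, 1 / (η ^ 2 * (L i - y))

/-- The potential: the optimal value `min_w ⟨w, L⟩ - (2/η) ∑ √w_i`. -/
def potential (hη : 0 < η) (L : Fin K → ℝ) : ℝ := dualObjective η L (normalizer hη L)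

/-- The normalizer maximizes the dual objective, which is concave. -/
theorem dualObjective_le_potential (hη : 0 < η) (L : Fin K → ℝ) {y : ℝ} (hy : ∀ i, y < L i) :
    dualObjective η L y ≤ potential hη L := by
  set z := normalizer hη L with hz
  have h1 : ∀ i, 1 / (η ^ 2 * (L i - z)) + (y - z) * weight hη L i ≤ 1 / (η ^ 2 * (L i - y)) := by
    intro i
    have ha : 0 < L i - z := sub_pos.2 (normalizer_lt hη L i)
    have hb : 0 < L i - y := sub_pos.2 (hy i)
    have : 1 / (η ^ 2 * (L i - y)) - (1 / (η ^ 2 * (L i - z)) + (y - z) * weight hη L i)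
        = (y - z) ^ 2 / (η ^ 2 * (L i - y) * (L i - z) ^ 2) := by
      rw [weight, ← hz]
      field_simp
      ring
    have h0 : 0 ≤ (y - z) ^ 2 / (η ^ 2 * (L i - y) * (L i - z) ^ 2) := by positivity
    linarith
  have h2 := Finset.sum_le_sum fun i (_ : i ∈ Finset.univ) => h1 i
  rw [Finset.sum_add_distrib, ← Finset.mul_sum, sum_weight] at h2
  unfold potential dualObjective
  rw [← hz]
  linarith

theorem potential_le (hη : 0 < η) (L : Fin K → ℝ) (j : Fin K) : potential hη L ≤ L j := by
  have h : 0 ≤ ∑ i, 1 / (η ^ 2 * (L i - normalizer hη L)) := Finset.sum_nonneg fun i _ => by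
    have := sub_pos.2 (normalizer_lt hη L i)
    positivity
  unfold potential dualObjective
  linarith [normalizer_lt hη L j]

theorem le_potential_zero (hη : 0 < η) : -(2 * √K / η) ≤ potential hη (0 : Fin K → ℝ) := by
  have hK : (0 : ℝ) < K := by exact_mod_cast Nat.pos_of_ne_zero (NeZero.ne K)
  have hs : 0 < √(K : ℝ) := Real.sqrt_pos.2 hK
  have h := dualObjective_le_potential hη (0 : Fin K → ℝ) (y := -(√K / η)) fun i => by
    simp only [Pi.zero_apply, Left.neg_neg_iff]; positivity
  refine le_trans (le_of_eq ?_) h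
  have hsq : √(K : ℝ) * √K = K := Real.mul_self_sqrt hK.le
  simp only [dualObjective, Pi.zero_apply, Finset.sum_const, Finset.card_univ, Fintype.card_fin,
    nsmul_eq_mul, zero_sub, neg_neg]
  field_simp
  nlinarith

/-- The cumulative loss estimates after arm `i` is pulled with loss `l`, importance-weighted. -/
def updateLoss (hη : 0 < η) (L : Fin K → ℝ) (i : Fin K) (l : ℝ) : Fin K → ℝ :=
  L + Pi.single i (l / weight hη L i)

/-- One round of the forecaster, with the multiplier of the previous round as a dual candidate. -/
theorem potential_add_le (hη : 0 < η) (L : Fin K → ℝ) (i : Fin K) {l : ℝ} (hl : l ∈ Icc (0 : ℝ) 1) :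
    potential hη L + l - η / √(weight hη L i) ≤ potential hη (updateLoss hη L i l) := by
  set z := normalizer hη L with hz
  have hd : 0 < L i - z := sub_pos.2 (normalizer_lt hη L i)
  set c := l / weight hη L i with hc
  have hc0 : 0 ≤ c := div_nonneg hl.1 (weight_pos hη L i).le
  have hlt : ∀ j, z < updateLoss hη L i l j := by
    intro j
    have h1 := normalizer_lt hη L j
    have h2 : 0 ≤ (Pi.single i c : Fin K → ℝ) j := by
      by_cases h : j = i
      · subst h; simpa using hc0
      · simp [h]
    simp only [updateLoss, Pi.add_apply]
    linarith
  refine le_trans ?_ (dualObjective_le_potential hη _ hlt)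
  have hsum : ∑ j, 1 / (η ^ 2 * (updateLoss hη L i l j - z))
      = ∑ j, 1 / (η ^ 2 * (L j - z))
        - (1 / (η ^ 2 * (L i - z)) - 1 / (η ^ 2 * (L i + c - z))) := by
    have h1 : ∀ j, 1 / (η ^ 2 * (updateLoss hη L i l j - z)) = 1 / (η ^ 2 * (L j - z))
        - (Pi.single i (1 / (η ^ 2 * (L i - z)) - 1 / (η ^ 2 * (L i + c - z))) : Fin K → ℝ) j := by
      intro j
      by_cases h : j = i
      · subst h; simp [updateLoss, ← hc]
      · simp [updateLoss, h]
    simp only [h1]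
    rw [Finset.sum_sub_distrib, Finset.sum_pi_single']
    simp
  unfold potential dualObjective
  rw [← hz, hsum]
  have hcl : c = l * (η * (L i - z)) ^ 2 := by
    rw [hc, weight, ← hz]; field_simp
  have hsq : η / √(weight hη L i) = η * (η * (L i - z)) := by
    rw [sqrt_weight, ← hz]; field_simp
  rw [hsq]
  have hdc : 0 < L i + c - z := by linarith
  have e1 : 1 / (η ^ 2 * (L i - z)) - 1 / (η ^ 2 * (L i + c - z))
      = l * (L i - z) / (L i + c - z) := by
    have : 1 / (η ^ 2 * (L i - z)) - 1 / (η ^ 2 * (L i + c - z))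
      = c / (η ^ 2 * (L i - z) * (L i + c - z)) := by
      field_simp
      ring
    rw [this, hcl]
    field_simp
  have e2 : l - η * (η * (L i - z)) ≤ l * (L i - z) / (L i + c - z) := by
    rw [le_div_iff₀ hdc]
    have hll : l * l ≤ l := by nlinarith [hl.1, hl.2]
    have e3 : l * c ≤ η * (η * (L i - z)) * (L i - z) := by
      rw [hcl]
      have : l * (l * (η * (L i - z)) ^ 2) = (l * l) * (η * (L i - z)) ^ 2 := by ring
      rw [this]
      have h1 : l * l ≤ 1 := hll.trans hl.2
      nlinarith [sq_nonneg (η * (L i - z))]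
    have e4 : 0 ≤ η * (η * (L i - z)) * c := by positivity
    nlinarith
  rw [e1]
  linarith

end Forecaster

section Regret

variable {K : ℕ} [NeZero K] (x : Fin K → I) {η : ℝ} (hη : 0 < η)

/-- The loss `1 - p z` of a round with price `p` and feedback `z`. -/
def roundLoss (p : I) (z : Bool) : ℝ := 1 - p * (if z then 1 else 0)

theorem roundLoss_mem (p : I) (z : Bool) : roundLoss p z ∈ Icc (0 : ℝ) 1 := by
  have h0 := p.2.1
  have h1 := p.2.2
  cases z <;> simp [roundLoss, h0, h1]

/-- The cumulative loss estimates of the arms after the first `t` rounds. -/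
def lossEstimate : (t : ℕ) → ArmHistory K t → Fin K → ℝ
  | 0, _ => 0
  | t + 1, e => updateLoss hη (lossEstimate t (Fin.init (α := fun _ => Fin K × Bool) e))
      (e (Fin.last t)).1 (roundLoss (x (e (Fin.last t)).1) (e (Fin.last t)).2)

theorem lossEstimate_snoc {t : ℕ} (e : ArmHistory K t) (i : Fin K) (z : Bool) :
    lossEstimate x hη (t + 1) (Fin.snoc (α := fun _ => Fin K × Bool) e (i, z))
      = updateLoss hη (lossEstimate x hη t e) i (roundLoss (x i) z) := by
  simp only [lossEstimate, Fin.init_snoc, Fin.snoc_last]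

variable {x}

/-- The forecaster, run on the arms `x`, has regret `O(√(K T))` against every arm. -/
theorem exists_policy_regret_arms (hη : 0 < η) (hx : Function.Injective x) :
    ∃ A : Policy, ∀ (N : ℕ) (D : Fin N → ProbabilityMeasure ℝ) (T : ℕ) (j : Fin K),
      T * revenue D (x j) - ∫ ω, ∑ t ∈ Finset.range T, revenue D (A.postedPrice ω t) ∂(A.law D)
        ≤ 2 * √K / η + η * √K * T := by
  set w : ∀ t, ArmHistory K t → Fin K → ℝ := fun t e => weight hη (lossEstimate x hη t e) with hw
  have hex := fun t e => exists_sampler (w t e) (fun i => (weight_pos hη _ i).le) (sum_weight hη _)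
  choose a ha haw using hex
  refine ⟨samplerPolicy x a ha, fun N D T j => ?_⟩
  set A := samplerPolicy x a ha with hA
  set S : ∀ t, A.Sample N → Fin K → ℝ := fun t ω => lossEstimate x hη t (pulls x a ha ω t) with hS
  -- Functions of the finitely many arm histories are bounded and measurable.
  have hint : ∀ (t : ℕ) (g : ArmHistory K t → ℝ),
      Integrable (fun ω : A.Sample N => g (pulls x a ha ω t)) (A.law D) := by
    intro t g
    obtain ⟨C, hC⟩ := (finite_range fun e => |g e|).bddAbove
    exact integrable_of_abs_le ((measurable_of_countable g).comp (measurable_pulls x a ha t))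
      fun ω => hC ⟨_, rfl⟩
  have hrev : ∀ t, ∫ ω, revenue D (A.postedPrice ω t) ∂(A.law D)
      = ∫ ω, ∑ i, w t (pulls x a ha ω t) i * revenue D (x i) ∂(A.law D) := fun t =>
    integral_samplerPolicy_price x ha D w haw t (fun _ p => revenue D p)
      (fun _ => measurable_revenue D) (C := 1) fun _ p => abs_revenue_le_one D p
  have hmean : ∀ i, saleProb D (x i) * roundLoss (x i) true
      + (1 - saleProb D (x i)) * roundLoss (x i) false = 1 - revenue D (x i) := by
    intro i
    simp only [roundLoss, revenue_eq, if_true, Bool.false_eq_true, if_false]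
    ring
  -- The estimate of the loss of arm `j` is unbiased.
  have hest : ∀ t, ∫ ω, S t ω j ∂(A.law D) = t * (1 - revenue D (x j)) := by
    intro t
    induction t with
    | zero => simp [hS, lossEstimate]
    | succ t ih =>
      have h1 := integral_pulls_succ ha D hx w haw t
        (fun e => lossEstimate x hη (t + 1) e j)
      have h2 : ∀ e : ArmHistory K t, ∑ i, w t e i *
          (saleProb D (x i) * lossEstimate x hη (t + 1)
              (Fin.snoc (α := fun _ => Fin K × Bool) e (i, true)) j
            + (1 - saleProb D (x i)) * lossEstimate x hη (t + 1)
              (Fin.snoc (α := fun _ => Fin K × Bool) e (i, false)) j)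
          = lossEstimate x hη t e j + (1 - revenue D (x j)) := by
        intro e
        simp only [lossEstimate_snoc, updateLoss, Pi.add_apply]
        have h3 : ∀ i, w t e i * (saleProb D (x i) * (lossEstimate x hη t e j
              + (Pi.single i (roundLoss (x i) true / weight hη (lossEstimate x hη t e) i)
                : Fin K → ℝ) j)
            + (1 - saleProb D (x i)) * (lossEstimate x hη t e j
              + (Pi.single i (roundLoss (x i) false / weight hη (lossEstimate x hη t e) i)
                : Fin K → ℝ) j))
            = w t e i * lossEstimate x hη t e j
              + (if j = i then 1 - revenue D (x i) else 0) := by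
          intro i
          have hwp : w t e i ≠ 0 := (weight_pos hη _ i).ne'
          by_cases h : j = i
          · subst h
            rw [if_pos rfl, ← hmean]
            simp only [Pi.single_eq_same]
            have : weight hη (lossEstimate x hη t e) j = w t e j := rfl
            rw [this]
            field_simp
            ring
          · simp only [h, if_false, Pi.single_eq_of_ne h]
            ring
        simp only [h3]
        rw [Finset.sum_add_distrib, ← Finset.sum_mul, sum_weight]
        simp
      simp only [h2] at h1
      refine h1.trans ?_
      rw [integral_add (hint t fun e => lossEstimate x hη t e j) (integrable_const _)]
      have ih' : ∫ ω, lossEstimate x hη t (pulls x a ha ω t) j ∂(A.law D)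
          = t * (1 - revenue D (x j)) := ih
      rw [ih']
      simp
      ring
  have hpot : ∀ t, ∫ ω, potential hη (S t ω) ∂(A.law D)
      + (1 - ∫ ω, revenue D (A.postedPrice ω t) ∂(A.law D)) - η * √K
      ≤ ∫ ω, potential hη (S (t + 1) ω) ∂(A.law D) := by
    intro t
    have h1 := integral_pulls_succ ha D hx w haw t
      (fun e => potential hη (lossEstimate x hη (t + 1) e))
    have h2 : ∀ e : ArmHistory K t, potential hη (lossEstimate x hη t e)
          + (1 - ∑ i, w t e i * revenue D (x i)) - η * √K ≤ ∑ i, w t e i *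
          (saleProb D (x i) * potential hη (lossEstimate x hη (t + 1)
              (Fin.snoc (α := fun _ => Fin K × Bool) e (i, true)))
            + (1 - saleProb D (x i)) * potential hη (lossEstimate x hη (t + 1)
              (Fin.snoc (α := fun _ => Fin K × Bool) e (i, false)))) := by
      intro e
      simp only [lossEstimate_snoc]
      set L := lossEstimate x hη t e with hL
      have h3 : ∀ i, w t e i * potential hη L + (w t e i - w t e i * revenue D (x i))
          - η * √(weight hη L i) ≤ w t e i *
          (saleProb D (x i) * potential hη (updateLoss hη L i (roundLoss (x i) true))
            + (1 - saleProb D (x i)) *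
              potential hη (updateLoss hη L i (roundLoss (x i) false))) := by
        intro i
        have hwp : 0 < w t e i := weight_pos hη _ i
        have q0 := saleProb_nonneg D (x i)
        have q1 := saleProb_le_one D (x i)
        have b1 := mul_le_mul_of_nonneg_left
          (potential_add_le hη L i (roundLoss_mem (x i) true)) q0
        have b2 := mul_le_mul_of_nonneg_left
          (potential_add_le hη L i (roundLoss_mem (x i) false)) (sub_nonneg.2 q1)
        have hm := hmean i
        have hsq : w t e i * (η / √(weight hη L i)) = η * √(weight hη L i) := by
          have : w t e i = √(weight hη L i) * √(weight hη L i) :=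
            (Real.mul_self_sqrt hwp.le).symm
          have hs : √(weight hη L i) ≠ 0 := (Real.sqrt_pos.2 hwp).ne'
          rw [this]
          field_simp
        have b3 := mul_le_mul_of_nonneg_left (add_le_add b1 b2) hwp.le
        refine le_trans (le_of_eq ?_) b3
        rw [← hsq]
        have : revenue D (x i) = 1 - (saleProb D (x i) * roundLoss (x i) true
          + (1 - saleProb D (x i)) * roundLoss (x i) false) := by linarith
        rw [this]
        ring
      refine le_trans ?_ (Finset.sum_le_sum fun i _ => h3 i)
      rw [Finset.sum_sub_distrib, Finset.sum_add_distrib, Finset.sum_sub_distrib,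
        ← Finset.sum_mul, ← Finset.mul_sum, sum_weight]
      have := mul_le_mul_of_nonneg_left (sum_sqrt_weight_le hη L) hη.le
      linarith
    rw [hrev t]
    have i1 := hint t fun e => potential hη (lossEstimate x hη t e)
    have i2 := hint t fun e => ∑ i, w t e i * revenue D (x i)
    have i3 := hint t fun e => ∑ i, w t e i *
          (saleProb D (x i) * potential hη (lossEstimate x hη (t + 1)
              (Fin.snoc (α := fun _ => Fin K × Bool) e (i, true)))
            + (1 - saleProb D (x i)) * potential hη (lossEstimate x hη (t + 1)
              (Fin.snoc (α := fun _ => Fin K × Bool) e (i, false))))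
    have i4 : Integrable (fun ω : A.Sample N =>
        1 - ∑ i, w t (pulls x a ha ω t) i * revenue D (x i)) (A.law D) :=
      (integrable_const _).sub i2
    have i5 : Integrable (fun ω : A.Sample N =>
        potential hη (lossEstimate x hη t (pulls x a ha ω t))
          + (1 - ∑ i, w t (pulls x a ha ω t) i * revenue D (x i))) (A.law D) := i1.add i4
    have hmono := integral_mono (i5.sub (integrable_const (η * √K))) i3
      fun ω => h2 (pulls x a ha ω t)
    refine le_trans (le_of_eq ?_) (hmono.trans (le_of_eq h1.symm))
    have e := integral_sub i5 (integrable_const (μ := A.law D) (η * √K))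
    rw [integral_add i1 i4, integral_sub (integrable_const _) i2] at e
    simp only [integral_const, probReal_univ, smul_eq_mul, one_mul] at e
    exact e.symm
  have htel : ∀ t : ℕ, -(2 * √K / η) + ∑ u ∈ Finset.range t,
      ((1 - ∫ ω, revenue D (A.postedPrice ω u) ∂(A.law D)) - η * √K)
      ≤ ∫ ω, potential hη (S t ω) ∂(A.law D) := by
    intro t
    induction t with
    | zero =>
      have : ∀ ω : A.Sample N, S 0 ω = 0 := fun ω => rfl
      simpa [this] using le_potential_zero hη
    | succ t ih =>
      rw [Finset.sum_range_succ]
      linarith [hpot t]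
  have hfin : ∫ ω, potential hη (S T ω) ∂(A.law D) ≤ T * (1 - revenue D (x j)) := by
    rw [← hest T]
    exact integral_mono (hint T fun e => potential hη (lossEstimate x hη T e))
      (hint T fun e => lossEstimate x hη T e j) fun ω => potential_le hη _ j
  have hi : ∀ t, Integrable (fun ω : A.Sample N => revenue D (A.postedPrice ω t)) (A.law D) :=
    fun t => integrable_of_abs_le ((measurable_revenue D).comp (measurable_postedPrice A t))
      fun _ => abs_revenue_le_one D _
  rw [integral_finsetSum _ fun t _ => hi t]
  have h := (htel T).trans hfin
  simp only [Finset.sum_sub_distrib, Finset.sum_const, Finset.card_range, nsmul_eq_mul,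
    mul_one] at h
  linarith

end Regret

/-! ### Upper bounds -/

/-- The price `i / m` of a uniform grid of `[0,1]`. -/
def gridPrice (m : ℕ) (i : Fin (m + 1)) : I :=
  ⟨i / m, by positivity, div_le_one_of_le₀ (by exact_mod_cast Nat.lt_succ_iff.1 i.2)
    (by positivity)⟩

theorem gridPrice_injective {m : ℕ} (hm : 0 < m) : Function.Injective (gridPrice m) := by
  intro i j h
  have hm' : (m : ℝ) ≠ 0 := by positivity
  have h1 : (i : ℝ) / m = j / m := congrArg Subtype.val h
  rw [div_left_inj' hm'] at h1
  exact Fin.ext (by exact_mod_cast h1)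

/-- Rounding a price down to the grid loses at most the mesh: the price drops by at most `1 / m` and
the probability of a sale does not drop. -/
theorem exists_gridPrice_revenue {N : ℕ} (D : Fin N → ProbabilityMeasure ℝ) {m : ℕ} (hm : 0 < m)
    (p : I) : ∃ i, revenue D p ≤ revenue D (gridPrice m i) + 1 / m := by
  have hm' : (0 : ℝ) < m := by positivity
  have hp0 : 0 ≤ (p : ℝ) := p.2.1
  have hfl : ⌊(p : ℝ) * m⌋₊ ≤ m := by
    refine Nat.floor_le_of_le ?_
    nlinarith [p.2.2]
  refine ⟨⟨⌊(p : ℝ) * m⌋₊, Nat.lt_succ_of_le hfl⟩, ?_⟩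
  set i : Fin (m + 1) := ⟨⌊(p : ℝ) * m⌋₊, Nat.lt_succ_of_le hfl⟩ with hi
  have hiv : (gridPrice m i : ℝ) = (⌊(p : ℝ) * m⌋₊ : ℝ) / m := rfl
  have hle : (gridPrice m i : ℝ) ≤ p := by
    rw [hiv, div_le_iff₀ hm']
    exact Nat.floor_le (by positivity)
  have hge : (p : ℝ) ≤ gridPrice m i + 1 / m := by
    rw [hiv, ← add_div, le_div_iff₀ hm']
    exact (Nat.lt_floor_add_one _).le
  have hq := antitone_saleProb D (show gridPrice m i ≤ p from hle)
  rw [revenue_eq, revenue_eq]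
  have h0 := saleProb_nonneg D p
  have h1 := saleProb_le_one D p
  have h2 : (p : ℝ) * saleProb D p ≤ (gridPrice m i + 1 / m) * saleProb D p := by gcongr
  have h3 : (gridPrice m i : ℝ) * saleProb D p ≤ gridPrice m i * saleProb D (gridPrice m i) :=
    mul_le_mul_of_nonneg_left hq (gridPrice m i).2.1
  have h4 : 1 / (m : ℝ) * saleProb D p ≤ 1 / m := mul_le_of_le_one_right (by positivity) h1
  linarith

/-- The forecaster on a grid of mesh `T^{-1/3}`: both the discretization and the `T^{1/3}` arms cost
`O(T^{2/3})`. -/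
theorem exists_policy_regret_le {T : ℕ} (hT : 0 < T) :
    ∃ A : Policy, ∀ (N : ℕ) (D : Fin N → ProbabilityMeasure ℝ),
      A.regret D T ≤ 7 * (T : ℝ) ^ (2 / 3 : ℝ) := by
  have hT' : (1 : ℝ) ≤ T := by exact_mod_cast hT
  set s : ℝ := (T : ℝ) ^ (1 / 3 : ℝ) with hs
  have hs1 : 1 ≤ s := Real.one_le_rpow hT' (by norm_num)
  have hs3 : s ^ 3 = T := by
    rw [hs, ← Real.rpow_natCast, ← Real.rpow_mul (by positivity)]
    norm_num
  have hs2 : (T : ℝ) ^ (2 / 3 : ℝ) = s ^ 2 := by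
    rw [hs, ← Real.rpow_natCast, ← Real.rpow_mul (by positivity)]
    norm_num
  rw [hs2]
  set m := ⌈s⌉₊ with hm
  have hm0 : 0 < m := Nat.ceil_pos.2 (by linarith)
  have hsm : s ≤ m := Nat.le_ceil s
  have hms : (m : ℝ) ≤ s + 1 := (Nat.ceil_lt_add_one (by linarith)).le
  have hη : 0 < 1 / √(T : ℝ) := by positivity
  obtain ⟨A, hA⟩ := exists_policy_regret_arms hη (gridPrice_injective hm0)
  refine ⟨A, fun N D => ?_⟩
  obtain ⟨j, hj⟩ := Finite.exists_max fun i => revenue D (gridPrice m i)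
  have hopt : optRevenue D ≤ revenue D (gridPrice m j) + 1 / m := by
    refine ciSup_le fun p => ?_
    obtain ⟨i, hi⟩ := exists_gridPrice_revenue D hm0 p
    linarith [hj i]
  have h1 := hA N D T j
  have hTs : (T : ℝ) / m ≤ s ^ 2 := by
    rw [div_le_iff₀ (by positivity), ← hs3]
    nlinarith [sq_nonneg s]
  have hsq : √(T : ℝ) * √T = T := Real.mul_self_sqrt (by positivity)
  have hKT : √((m + 1 : ℕ) : ℝ) * √T ≤ 2 * s ^ 2 := by
    rw [← Real.sqrt_mul (by positivity)]
    refine Real.sqrt_le_iff.2 ⟨by positivity, ?_⟩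
    rw [← hs3]
    push_cast
    have : ((m : ℝ) + 1) * s ^ 3 ≤ (4 * s) * s ^ 3 := by
      gcongr; linarith
    nlinarith
  have e1 : 2 * √((m + 1 : ℕ) : ℝ) / (1 / √(T : ℝ)) = 2 * (√((m + 1 : ℕ) : ℝ) * √T) := by
    field_simp
  have e2 : 1 / √(T : ℝ) * √((m + 1 : ℕ) : ℝ) * T = √((m + 1 : ℕ) : ℝ) * √T := by
    nth_rewrite 2 [← hsq]
    field_simp
  rw [e1, e2] at h1
  have h2 : (T : ℝ) * optRevenue D ≤ T * revenue D (gridPrice m j) + T / m := by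
    have := mul_le_mul_of_nonneg_left hopt (show (0 : ℝ) ≤ T by positivity)
    rw [mul_add, mul_one_div] at this
    exact this
  unfold Policy.regret
  linarith

theorem minimaxRegret_le (𝓓 : Set (ProbabilityMeasure ℝ)) (N : ℕ) {T : ℕ} (hT : 0 < T) :
    minimaxRegret 𝓓 N T ≤ ((7 * (T : ℝ) ^ (2 / 3 : ℝ) : ℝ) : EReal) := by
  obtain ⟨A, hA⟩ := exists_policy_regret_le hT
  exact iInf_le_of_le A (iSup₂_le fun D _ => EReal.coe_le_coe (hA N D))

theorem sureQueryComplexity_le (𝓓 : Set (ProbabilityMeasure ℝ)) (N : ℕ) {ε : ℝ} (hε : 0 < ε)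
    (hε1 : ε ≤ 1) : sureQueryComplexity 𝓓 N ε ≤ ENNReal.ofReal (141 ^ 3 / ε ^ 3) := by
  set T := ⌈(140 / ε) ^ 3⌉₊ with hT
  have hT0 : 0 < T := Nat.ceil_pos.2 (by positivity)
  have hlow : (140 / ε) ^ 3 ≤ T := Nat.le_ceil _
  have hup : (T : ℝ) ≤ (140 / ε) ^ 3 + 1 := (Nat.ceil_lt_add_one (by positivity)).le
  have : NeZero T := ⟨hT0.ne'⟩
  obtain ⟨A, hA⟩ := exists_policy_regret_le hT0
  set s : ℝ := (T : ℝ) ^ (1 / 3 : ℝ) with hs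
  have hs0 : 0 ≤ s := by positivity
  have hs3 : s ^ 3 = T := by
    rw [hs, ← Real.rpow_natCast, ← Real.rpow_mul (by positivity)]
    norm_num
  have hs2 : (T : ℝ) ^ (2 / 3 : ℝ) = s ^ 2 := by
    rw [hs, ← Real.rpow_natCast, ← Real.rpow_mul (by positivity)]
    norm_num
  have hsε : 140 ≤ s * ε := by
    rw [← hs3] at hlow
    have := le_of_pow_le_pow_left₀ (by norm_num) hs0 hlow
    rwa [div_le_iff₀ hε] at this
  refine (sureQueryComplexity_le_of_regret_le A T 𝓓 hε fun D _ => (hA N D).trans ?_).trans ?_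
  · rw [hs2, ← hs3]
    nlinarith [sq_nonneg s]
  · rw [← ENNReal.ofReal_natCast]
    refine ENNReal.ofReal_le_ofReal (hup.trans ?_)
    have h1 : 1 ≤ 1 / ε ^ 3 := by
      rw [le_div_iff₀ (by positivity), one_mul]
      exact pow_le_one₀ hε.le hε1
    have h2 : (140 / ε) ^ 3 = 140 ^ 3 * (1 / ε ^ 3) := by ring
    have h3 : (141 : ℝ) ^ 3 / ε ^ 3 = 141 ^ 3 * (1 / ε ^ 3) := by ring
    rw [h2, h3]
    nlinarith

/-! ### Distributions with a prescribed CDF -/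

theorem exists_leftCDF_eq {F : ℝ → ℝ} (hmono : Monotone F) (h0 : ∀ x ≤ 0, F x = 0)
    (h1 : ∀ x, 1 < x → F x = 1) (hcont : ∀ x, ContinuousWithinAt F (Iic x) x) :
    ∃ D ∈ generalFamily, leftCDF D = F := by
  -- Reflecting at `0` turns the left-continuous `F` into a right-continuous function.
  let S : StieltjesFunction ℝ :=
    { toFun := fun y => -F (-y)
      mono' := fun a b hab => neg_le_neg (hmono (neg_le_neg hab))
      right_continuous' := fun y =>
        ((hcont (-y)).comp (s := Ici y) continuous_neg.continuousWithinAt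
          fun z hz => neg_le_neg (mem_Ici.1 hz)).neg }
  have hS : ∀ y, S y = -F (-y) := fun _ => rfl
  have htop : Tendsto S atTop (𝓝 0) := by
    refine tendsto_const_nhds.congr' ?_
    filter_upwards [eventually_ge_atTop 0] with y hy
    rw [hS, h0 _ (by linarith), neg_zero]
  have hbot : Tendsto S atBot (𝓝 (-1)) := by
    refine tendsto_const_nhds.congr' ?_
    filter_upwards [eventually_lt_atBot (-1)] with y hy
    rw [hS, h1 _ (by linarith)]
  have hprob : IsProbabilityMeasure S.measure :=
    ⟨by rw [S.measure_univ hbot htop]; norm_num⟩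
  have hneg : Measurable (fun y : ℝ => -y) := measurable_neg
  refine ⟨⟨S.measure.map fun y => -y, Measure.isProbabilityMeasure_map hneg.aemeasurable⟩,
    ?_, ?_⟩
  · show S.measure.map (fun y => -y) (Icc 0 1) = 1
    rw [Measure.map_apply hneg measurableSet_Icc]
    have : (fun y : ℝ => -y) ⁻¹' Icc 0 1 = Icc (-1) 0 := by
      ext y
      simp only [mem_preimage, mem_Icc]
      constructor <;> rintro ⟨h, h'⟩ <;> constructor <;> linarith
    rw [this, S.measure_Icc]
    have hl : Function.leftLim S (-1) = -1 := by
      refine leftLim_eq_of_tendsto ?_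
      refine tendsto_const_nhds.congr' ?_
      filter_upwards [self_mem_nhdsWithin] with y hy
      have : y < -1 := hy
      rw [hS, h1 _ (by linarith)]
    rw [hl, hS, neg_zero, h0 0 le_rfl]
    norm_num
  · funext x
    show (S.measure.map fun y => -y).real (Iio x) = F x
    rw [map_measureReal_apply hneg measurableSet_Iio]
    have : (fun y : ℝ => -y) ⁻¹' Iio x = Ioi (-x) := by
      ext y
      simp only [mem_preimage, mem_Iio, mem_Ioi]
      constructor <;> intro h <;> linarith
    rw [this, Measure.real, S.measure_Ioi htop, hS, neg_neg, ENNReal.toReal_ofReal]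
    · ring
    · have := hmono (min_le_right x 0)
      have h2 := hmono (min_le_left x 0)
      rw [h0 _ (min_le_right x 0)] at h2
      linarith

/-- `g` is continuous on `[a,c]`, with right-hand derivative `g' ≥ 0` on `[a,c)`. -/
structure HasRightDensity (a c : ℝ) (g g' : ℝ → ℝ) : Prop where
  cont : ContinuousOn g (Icc a c)
  deriv : ∀ x ∈ Ico a c, HasDerivWithinAt g (g' x) (Ici x) x
  nonneg : ∀ x ∈ Ico a c, 0 ≤ g' x

theorem HasRightDensity.of_hasDerivAt {a c : ℝ} {g g' : ℝ → ℝ}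
    (h : ∀ x ∈ Icc a c, HasDerivAt g (g' x) x) (h0 : ∀ x ∈ Icc a c, 0 ≤ g' x) :
    HasRightDensity a c g g' where
  cont x hx := (h x hx).continuousAt.continuousWithinAt
  deriv x hx := (h x (Ico_subset_Icc_self hx)).hasDerivWithinAt
  nonneg x hx := h0 x (Ico_subset_Icc_self hx)

theorem HasRightDensity.monotoneOn {a c : ℝ} {g g' : ℝ → ℝ} (h : HasRightDensity a c g g') :
    MonotoneOn g (Icc a c) := by
  intro x hx y hy hxy
  have hsub : Icc x y ⊆ Icc a c := Icc_subset_Icc hx.1 hy.2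
  exact image_le_of_deriv_right_le_deriv_boundary (f := fun _ => g x) (f' := fun _ => 0) (B := g)
    (B' := g') continuousOn_const (fun _ _ => hasDerivWithinAt_const _ _ _) le_rfl
    (h.cont.mono hsub) (fun z hz => h.deriv z ⟨hx.1.trans hz.1, hz.2.trans_le hy.2⟩)
    (fun z hz => h.nonneg z ⟨hx.1.trans hz.1, hz.2.trans_le hy.2⟩) ⟨hxy, le_rfl⟩

/-- The function that is `u` before `b` and `v` from `b` on. -/
def glue (b : ℝ) (u v : ℝ → ℝ) (x : ℝ) : ℝ := if x < b then u x else v x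

theorem glue_of_lt {b x : ℝ} (u v : ℝ → ℝ) (h : x < b) : glue b u v x = u x := if_pos h

theorem glue_of_le {b x : ℝ} (u v : ℝ → ℝ) (h : b ≤ x) : glue b u v x = v x :=
  if_neg (not_lt.2 h)

theorem HasRightDensity.glue {a b c : ℝ} (hab : a ≤ b) (hbc : b ≤ c) {u u' v v' : ℝ → ℝ}
    (hu : HasRightDensity a b u u') (hv : HasRightDensity b c v v') (huv : u b = v b) :
    HasRightDensity a c (glue b u v) (glue b u' v') where
  cont := by
    rw [← Icc_union_Icc_eq_Icc hab hbc]
    refine ContinuousOn.union_of_isClosed (hu.cont.congr fun x hx => ?_)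
      (hv.cont.congr fun x hx => glue_of_le _ _ hx.1) isClosed_Icc isClosed_Icc
    rcases hx.2.lt_or_eq with h | rfl
    · exact glue_of_lt _ _ h
    · rw [glue_of_le _ _ le_rfl, huv]
  deriv x hx := by
    rcases lt_or_ge x b with h | h
    · rw [glue_of_lt _ _ h]
      refine (hu.deriv x ⟨hx.1, h⟩).congr_of_eventuallyEq ?_ (glue_of_lt _ _ h)
      filter_upwards [mem_nhdsWithin_of_mem_nhds (Iio_mem_nhds h)] with y hy
      exact glue_of_lt _ _ hy
    · rw [glue_of_le _ _ h]
      exact (hv.deriv x ⟨h, hx.2⟩).congr (fun y hy => glue_of_le _ _ (h.trans hy))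
        (glue_of_le _ _ h)
  nonneg x hx := by
    rcases lt_or_ge x b with h | h
    · rw [glue_of_lt _ _ h]; exact hu.nonneg x ⟨hx.1, h⟩
    · rw [glue_of_le _ _ h]; exact hv.nonneg x ⟨h, hx.2⟩

theorem MonotoneOn.glue_hazard {a b c : ℝ} {u u' v v' : ℝ → ℝ}
    (hu : MonotoneOn (fun x => u' x / (1 - u x)) (Ico a b))
    (hv : MonotoneOn (fun x => v' x / (1 - v x)) (Ico b c))
    (huv : ∀ x ∈ Ico a b, u' x / (1 - u x) ≤ v' b / (1 - v b)) :
    MonotoneOn (fun x => glue b u' v' x / (1 - glue b u v x)) (Ico a c) := by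
  intro x hx y hy hxy
  rcases lt_or_ge y b with h | h
  · simp only [glue_of_lt _ _ h, glue_of_lt _ _ (hxy.trans_lt h)]
    exact hu ⟨hx.1, hxy.trans_lt h⟩ ⟨hy.1, h⟩ hxy
  · rcases lt_or_ge x b with h' | h'
    · simp only [glue_of_le _ _ h, glue_of_lt _ _ h']
      exact (huv x ⟨hx.1, h'⟩).trans (hv ⟨le_rfl, h.trans_lt hy.2⟩ ⟨h, hy.2⟩ h)
    · simp only [glue_of_le _ _ h, glue_of_le _ _ h']
      exact hv ⟨h', hx.2⟩ ⟨h, hy.2⟩ hxy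

/-- The left-continuous CDF that is `g` on `[0,e]` and jumps to `1` after `e`. -/
def cutCDF (e : ℝ) (g : ℝ → ℝ) (x : ℝ) : ℝ := if x ≤ 0 then 0 else if x ≤ e then g x else 1

/-- `g`, with right-hand derivative `g'`, is the CDF on `[0,e]` of a distribution whose support
ends at `e ≤ 1`, possibly with an atom there. -/
structure IsProfile (e : ℝ) (g g' : ℝ → ℝ) : Prop where
  nonneg : 0 ≤ e
  le_one : e ≤ 1
  zero : g 0 = 0
  density : HasRightDensity 0 e g g'
  lt_one : ∀ x ∈ Ico 0 e, g x < 1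
  end_le : g e ≤ 1

section Profile

variable {e : ℝ} {g g' : ℝ → ℝ}

theorem IsProfile.cutCDF_of_mem (h : IsProfile e g g') {x : ℝ} (hx : x ∈ Icc 0 e) :
    cutCDF e g x = g x := by
  unfold cutCDF
  split_ifs with h1 h2
  · rw [le_antisymm h1 hx.1, h.zero]
  · rfl
  · exact absurd hx.2 h2

theorem IsProfile.cutCDF_of_lt (h : IsProfile e g g') {x : ℝ} (hx : e < x) :
    cutCDF e g x = 1 := by
  unfold cutCDF
  rw [if_neg (not_le.2 (h.nonneg.trans_lt hx)), if_neg (not_le.2 hx)]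

theorem IsProfile.exists_leftCDF (h : IsProfile e g g') :
    ∃ D ∈ generalFamily, leftCDF D = cutCDF e g := by
  have hle : ∀ x, cutCDF e g x ≤ 1 := by
    intro x
    unfold cutCDF
    split_ifs with h1 h2
    · exact zero_le_one
    · exact (h.density.monotoneOn ⟨(not_le.1 h1).le, h2⟩ ⟨h.nonneg, le_rfl⟩ h2).trans h.end_le
    · exact le_rfl
  have hpos : ∀ x, 0 ≤ cutCDF e g x := by
    intro x
    unfold cutCDF
    split_ifs with h1 h2
    · exact le_rfl
    · rw [← h.zero]
      exact h.density.monotoneOn ⟨le_rfl, h.nonneg⟩ ⟨(not_le.1 h1).le, h2⟩ (not_le.1 h1).le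
    · exact zero_le_one
  refine exists_leftCDF_eq ?_ (fun x hx => if_pos hx)
    (fun x hx => h.cutCDF_of_lt (h.le_one.trans_lt hx)) ?_
  · intro x y hxy
    rcases le_or_gt x 0 with hx | hx
    · calc cutCDF e g x = 0 := if_pos hx
        _ ≤ _ := hpos y
    rcases le_or_gt y e with hy | hy
    · rw [h.cutCDF_of_mem ⟨hx.le, hxy.trans hy⟩, h.cutCDF_of_mem ⟨hx.le.trans hxy, hy⟩]
      exact h.density.monotoneOn ⟨hx.le, hxy.trans hy⟩ ⟨hx.le.trans hxy, hy⟩ hxy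
    · rw [h.cutCDF_of_lt hy]
      exact hle x
  · intro x
    rcases le_or_gt x 0 with hx | hx
    · exact (continuousWithinAt_const (b := (0 : ℝ))).congr
        (fun y hy => if_pos (le_trans hy hx)) (if_pos hx)
    rcases le_or_gt x e with hxe | hxe
    · have h1 := (h.density.cont x ⟨hx.le, hxe⟩).congr
        (fun y hy => h.cutCDF_of_mem hy) (h.cutCDF_of_mem ⟨hx.le, hxe⟩)
      refine h1.mono_of_mem_nhdsWithin ?_
      filter_upwards [mem_nhdsWithin_of_mem_nhds (Ioi_mem_nhds hx), self_mem_nhdsWithin] with y h2 h3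
      exact ⟨le_of_lt h2, le_trans h3 hxe⟩
    · refine ContinuousAt.continuousWithinAt ?_
      refine (continuousAt_const (y := (1 : ℝ))).congr ?_
      filter_upwards [Ioi_mem_nhds hxe] with y hy
      exact (h.cutCDF_of_lt hy).symm

/-- The generalized density of a profile: infinite at the end of the support if there is an atom. -/
def cutDensity (e : ℝ) (g g' : ℝ → ℝ) (x : ℝ) : ℝ≥0∞ :=
  if x < e then ENNReal.ofReal (g' x) else if x = e ∧ g e < 1 then ⊤ else 0

theorem IsProfile.isGenDensity (h : IsProfile e g g') :
    IsGenDensity (cutCDF e g) (cutDensity e g g') := by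
  rintro x ⟨hx0, -⟩
  rcases lt_trichotomy x e with hx | rfl | hx
  · rw [cutDensity, if_pos hx]
    refine ENNReal.tendsto_ofReal ?_
    have h1 := (hasDerivWithinAt_iff_tendsto_slope' (by simp)).1
      ((h.density.deriv x ⟨hx0, hx⟩).mono Ioi_subset_Ici_self)
    refine h1.congr' ?_
    filter_upwards [mem_nhdsWithin_of_mem_nhds (Iio_mem_nhds hx), self_mem_nhdsWithin]
      with y hy hxy
    have hxy' : x < y := hxy
    have hy' : y < e := hy
    rw [h.cutCDF_of_mem ⟨hx0, hx.le⟩, h.cutCDF_of_mem ⟨hx0.trans hxy'.le, hy'.le⟩,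
      slope_def_field]
  · rw [cutDensity, if_neg (lt_irrefl _)]
    split_ifs with hjump
    · have hpos : 0 < 1 - g x := sub_pos.2 hjump.2
      refine ENNReal.tendsto_ofReal_atTop.comp ?_
      have h1 : Tendsto (fun s : ℝ => (s - x)⁻¹) (𝓝[>] x) atTop := by
        refine tendsto_inv_nhdsGT_zero.comp (tendsto_nhdsWithin_iff.2 ⟨?_, ?_⟩)
        · have : Tendsto (fun s : ℝ => s - x) (𝓝 x) (𝓝 (x - x)) :=
            (continuous_id.sub continuous_const).tendsto x
          rw [sub_self] at this
          exact this.mono_left nhdsWithin_le_nhds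
        · filter_upwards [self_mem_nhdsWithin] with s hs
          exact sub_pos.2 (mem_Ioi.1 hs)
      refine (h1.const_mul_atTop hpos).congr' ?_
      filter_upwards [self_mem_nhdsWithin] with s hs
      rw [h.cutCDF_of_lt hs, h.cutCDF_of_mem ⟨hx0, le_rfl⟩, div_eq_mul_inv]
    · have hg : g x = 1 := le_antisymm h.end_le (not_lt.1 fun hlt => hjump ⟨rfl, hlt⟩)
      refine tendsto_const_nhds.congr' ?_
      filter_upwards [self_mem_nhdsWithin] with s hs
      rw [h.cutCDF_of_lt hs, h.cutCDF_of_mem ⟨hx0, le_rfl⟩, hg]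
      simp
  · have h2 : cutDensity e g g' x = 0 := by
      rw [cutDensity, if_neg (not_lt.2 hx.le), if_neg fun hh => hx.ne' hh.1]
    rw [h2]
    refine tendsto_const_nhds.congr' ?_
    filter_upwards [self_mem_nhdsWithin] with s hs
    have hs' : x < s := hs
    rw [h.cutCDF_of_lt hx, h.cutCDF_of_lt (hx.trans hs')]
    simp

theorem IsProfile.exists_mem_mhrFamily (h : IsProfile e g g')
    (hmono : MonotoneOn (fun x => g' x / (1 - g x)) (Ico 0 e)) :
    ∃ D ∈ mhrFamily, leftCDF D = cutCDF e g := by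
  obtain ⟨D, hD, hF⟩ := h.exists_leftCDF
  refine ⟨D, ⟨hD, cutDensity e g g', hF ▸ h.isGenDensity, ?_⟩, hF⟩
  rw [hF]
  rintro x ⟨⟨hx0, -⟩, hxF⟩ y ⟨⟨hy0, -⟩, hyF⟩ hxy
  have hye : y ≤ e := not_lt.1 fun hlt => by
    rw [h.cutCDF_of_lt hlt] at hyF
    exact lt_irrefl _ hyF
  rw [h.cutCDF_of_mem ⟨hy0, hye⟩] at hyF
  rcases hye.lt_or_eq with hlt | rfl
  · have hxe := hxy.trans_lt hlt
    have hval : ∀ z ∈ Ico 0 e, hazardRate (cutCDF e g) (cutDensity e g g') z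
        = ENNReal.ofReal (g' z / (1 - g z)) := by
      intro z hz
      rw [hazardRate, h.cutCDF_of_mem ⟨hz.1, hz.2.le⟩, cutDensity, if_pos hz.2,
        ENNReal.ofReal_div_of_pos (sub_pos.2 (h.lt_one z hz))]
    rw [hval x ⟨hx0, hxe⟩, hval y ⟨hy0, hlt⟩]
    exact ENNReal.ofReal_le_ofReal (hmono ⟨hx0, hxe⟩ ⟨hy0, hlt⟩ hxy)
  · have : hazardRate (cutCDF y g) (cutDensity y g g') y = ⊤ := by
      rw [hazardRate, cutDensity, if_neg (lt_irrefl _), if_pos ⟨rfl, hyF⟩]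
      exact ENNReal.top_div_of_ne_top ENNReal.ofReal_ne_top
    rw [this]
    exact le_top

theorem virtualValue_le (F : ℝ → ℝ) (f : ℝ → ℝ≥0∞) (x : ℝ) : virtualValue F f x ≤ x := by
  unfold virtualValue
  exact EReal.sub_le_of_le_add (le_add_of_nonneg_right (EReal.coe_ennreal_nonneg _))

theorem virtualValue_of_eq_one {F : ℝ → ℝ} {f : ℝ → ℝ≥0∞} {x : ℝ} (hx : F x = 1) :
    virtualValue F f x = x := by
  simp [virtualValue, hx]

theorem IsProfile.exists_mem_regularFamily (h : IsProfile e g g')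
    (hmono : ∀ x y, 0 ≤ x → x < y → y < e →
      g' x = 0 ∨ (0 < g' y ∧ x - (1 - g x) / g' x ≤ y - (1 - g y) / g' y)) :
    ∃ D ∈ regularFamily, leftCDF D = cutCDF e g := by
  obtain ⟨D, hD, hF⟩ := h.exists_leftCDF
  refine ⟨D, ⟨hD, cutDensity e g g', hF ▸ h.isGenDensity, ?_⟩, hF⟩
  rw [hF]
  rintro x ⟨hx0, -⟩ y ⟨hy0, -⟩ hxy
  rcases hxy.eq_or_lt with rfl | hxy
  · exact le_rfl
  rcases lt_or_ge y e with hy | hy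
  · have hx := hxy.trans hy
    have hposx := sub_pos.2 (h.lt_one x ⟨hx0, hx⟩)
    have hzero : g' x = 0 →
        virtualValue (cutCDF e g) (cutDensity e g g') x = ⊥ := by
      intro h0
      rw [virtualValue, h.cutCDF_of_mem ⟨hx0, hx.le⟩, cutDensity, if_pos hx, h0,
        ENNReal.ofReal_zero, ENNReal.div_zero (ENNReal.ofReal_pos.2 hposx).ne']
      simp
    have hval : ∀ z ∈ Ico 0 e, 0 < g' z →
        virtualValue (cutCDF e g) (cutDensity e g g') z
          = ((z - (1 - g z) / g' z : ℝ) : EReal) := by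
      intro z hz hz'
      rw [virtualValue, h.cutCDF_of_mem ⟨hz.1, hz.2.le⟩, cutDensity, if_pos hz.2,
        ← ENNReal.ofReal_div_of_pos hz', EReal.coe_ennreal_ofReal, max_eq_left, EReal.coe_sub]
      exact div_nonneg (sub_pos.2 (h.lt_one z hz)).le hz'.le
    rcases (h.density.nonneg x ⟨hx0, hx⟩).eq_or_lt with h0 | h0
    · rw [hzero h0.symm]
      exact bot_le
    · rcases hmono x y hx0 hxy hy with h1 | ⟨h1, h2⟩
      · exact absurd h1 h0.ne'
      · rw [hval x ⟨hx0, hx⟩ h0, hval y ⟨hy0, hy⟩ h1]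
        exact EReal.coe_le_coe h2
  · have hvy : virtualValue (cutCDF e g) (cutDensity e g g') y = y := by
      rcases hy.eq_or_lt with rfl | hlt
      · rcases h.end_le.eq_or_lt with h1 | h1
        · exact virtualValue_of_eq_one (by rw [h.cutCDF_of_mem ⟨hy0, le_rfl⟩, h1])
        · rw [virtualValue, cutDensity, if_neg (lt_irrefl _), if_pos ⟨rfl, h1⟩]
          simp
      · exact virtualValue_of_eq_one (h.cutCDF_of_lt hlt)
    rw [hvy]
    exact (virtualValue_le _ _ _).trans (EReal.coe_le_coe hxy.le)

end Profile

theorem monotone_leftCDF (D : ProbabilityMeasure ℝ) : Monotone (leftCDF D) := fun _ _ h =>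
  measureReal_mono (Iio_subset_Iio h)

theorem leftCDF_le_one (D : ProbabilityMeasure ℝ) (x : ℝ) : leftCDF D x ≤ 1 := measureReal_le_one

theorem mhrFamily_subset_regularFamily : mhrFamily ⊆ regularFamily := by
  rintro D ⟨hD, f, hf, hmono⟩
  refine ⟨hD, f, hf, fun x hx y hy hxy => ?_⟩
  rcases (leftCDF_le_one D y).eq_or_lt with h1 | hy1
  · rw [virtualValue_of_eq_one h1]
    exact (virtualValue_le _ _ _).trans (EReal.coe_le_coe hxy)
  · have hx1 : leftCDF D x < 1 := (monotone_leftCDF D hxy).trans_lt hy1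
    have h := hmono ⟨hx, hx1⟩ ⟨hy, hy1⟩ hxy
    have hinv : ∀ z, leftCDF D z < 1 →
        ENNReal.ofReal (1 - leftCDF D z) / f z = (hazardRate (leftCDF D) f z)⁻¹ := by
      intro z hz
      rw [hazardRate, ENNReal.inv_div (Or.inl ENNReal.ofReal_ne_top)
        (Or.inl (ENNReal.ofReal_pos.2 (sub_pos.2 hz)).ne')]
    unfold virtualValue
    rw [hinv x hx1, hinv y hy1]
    exact EReal.sub_le_sub (EReal.coe_le_coe hxy)
      (EReal.coe_ennreal_le_coe_ennreal_iff.2 (ENNReal.inv_le_inv.2 h))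

/-! ### Hard instances -/

/-- The CDF `1 - 1/(2x)` of the maximal bid at which every price in `[1/2,1]` has revenue `1/2`. -/
def flatCDF (x : ℝ) : ℝ := 1 - 1 / (2 * x)

/-- The factor of `flatCDF` that remains when one buyer has a uniform bid with CDF `x / 2`. -/
def flatFactor (x : ℝ) : ℝ := (2 * x - 1) / x ^ 2

/-- The factor `flatCDF x / (γ x²)` of `flatCDF`, with `γ` such that it reaches `1` at `p`. -/
def rampCDF (p x : ℝ) : ℝ := (2 * x - 1) * p ^ 3 / ((2 * p - 1) * x ^ 3)

/-- The polynomial factor of `1 - rampCDF p`. -/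
def rampFactor (p x : ℝ) : ℝ := p ^ 2 - (2 * p - 1) * (p * x + x ^ 2)

/-- The mass that `rampCDF p` leaves above `p - w`. -/
def rampMass (p w : ℝ) : ℝ := 1 - rampCDF p (p - w)

/-- The modification of `rampCDF p` on the window `[p - w, p]`: the survival function decays at the
constant rate `7 / w`, so that it is still of order `w` at `p`. The rate is at least the hazard rate
of `rampCDF p` at `p - w`, as the MHR property requires (`ramp_hazard_left_le`). -/
def tailCDF (p w x : ℝ) : ℝ := 1 - rampMass p w * Real.exp (-(7 / w) * (x - (p - w)))

theorem one_sub_rampCDF {p x : ℝ} (hp : 1 / 2 < p) (hx : 0 < x) :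
    1 - rampCDF p x = (p - x) * rampFactor p x / ((2 * p - 1) * x ^ 3) := by
  have : 0 < 2 * p - 1 := by linarith
  unfold rampCDF rampFactor
  field_simp
  ring

theorem le_rampFactor {p x : ℝ} (hp : 1 / 2 < p) (hp' : p ≤ 2 / 3) (hx : 0 < x) (hxp : x ≤ p) :
    p ^ 2 / 3 ≤ rampFactor p x := by
  have h1 : p * x + x ^ 2 ≤ 2 * p ^ 2 := by nlinarith
  have h2 : (2 * p - 1) * (p * x + x ^ 2) ≤ (2 * p - 1) * (2 * p ^ 2) :=
    mul_le_mul_of_nonneg_left h1 (by linarith)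
  unfold rampFactor
  nlinarith [sq_nonneg p]

theorem rampFactor_le {p x : ℝ} (hp : 1 / 2 < p) (hx : 0 < x) :
    rampFactor p x ≤ p ^ 2 := by
  have : 0 ≤ (2 * p - 1) * (p * x + x ^ 2) :=
    mul_nonneg (by linarith) (by nlinarith)
  unfold rampFactor
  linarith

theorem rampFactor_antitone {p x y : ℝ} (hp : 1 / 2 < p) (hx : 0 < x) (hxy : x ≤ y) :
    rampFactor p y ≤ rampFactor p x := by
  have h1 : p * x + x ^ 2 ≤ p * y + y ^ 2 := by nlinarith
  have h2 := mul_le_mul_of_nonneg_left h1 (show 0 ≤ 2 * p - 1 by linarith)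
  unfold rampFactor
  linarith

/-- The density of `rampCDF p`. -/
def rampDensity (p x : ℝ) : ℝ := p ^ 3 * (3 - 4 * x) / ((2 * p - 1) * x ^ 4)

theorem hasDerivAt_rampCDF {p x : ℝ} (hp : 1 / 2 < p) (hx : 0 < x) :
    HasDerivAt (rampCDF p) (rampDensity p x) x := by
  have hp0 : 2 * p - 1 ≠ 0 := by linarith
  have h1 : HasDerivAt (fun x : ℝ => (2 * x - 1) * p ^ 3) (2 * p ^ 3) x := by
    have := (((hasDerivAt_id x).const_mul 2).sub_const 1).mul_const (p ^ 3)
    simpa using this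
  have h2 : HasDerivAt (fun x : ℝ => (2 * p - 1) * x ^ 3) ((2 * p - 1) * (3 * x ^ 2)) x := by
    simpa using (hasDerivAt_pow 3 x).const_mul (2 * p - 1)
  have h3 := h1.div h2 (by positivity)
  refine h3.congr_deriv ?_
  unfold rampDensity
  field_simp
  ring

theorem ramp_hazard {p x : ℝ} (hp : 1 / 2 < p) (hp' : p ≤ 2 / 3) (hx : 0 < x) (hxp : x < p) :
    rampDensity p x / (1 - rampCDF p x)
      = p ^ 3 * ((3 - 4 * x) / (x * (p - x))) * (1 / rampFactor p x) := by
  have h1 : 0 < 2 * p - 1 := by linarith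
  have h2 : 0 < p - x := by linarith
  have h3 : 0 < rampFactor p x :=
    lt_of_lt_of_le (by positivity) (le_rampFactor hp hp' hx hxp.le)
  rw [one_sub_rampCDF hp hx, rampDensity]
  generalize 2 * p - 1 = q at h1 ⊢
  field_simp

theorem ramp_hazard_monotone {p x y : ℝ} (hp : 1 / 2 < p) (hp' : p ≤ 2 / 3) (hx : 1 / 2 ≤ x)
    (hxy : x ≤ y) (hyp : y < p) :
    rampDensity p x / (1 - rampCDF p x) ≤ rampDensity p y / (1 - rampCDF p y) := by
  have hx0 : 0 < x := by linarith
  have hy0 : 0 < y := by linarith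
  have hxp : 0 < p - x := by linarith
  have hyp' : 0 < p - y := by linarith
  rw [ramp_hazard hp hp' hx0 (by linarith), ramp_hazard hp hp' hy0 hyp]
  have hB : 0 < rampFactor p y :=
    lt_of_lt_of_le (by positivity) (le_rampFactor hp hp' hy0 hyp.le)
  have h3 : 0 ≤ 3 - 4 * y := by linarith
  have h1 : (3 - 4 * x) / (x * (p - x)) ≤ (3 - 4 * y) / (y * (p - y)) := by
    rw [div_le_div_iff₀ (by positivity) (by positivity)]
    have h4 : 0 ≤ 3 * (x + y) - 4 * x * y - 3 * p := by nlinarith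
    nlinarith [mul_nonneg (sub_nonneg.2 hxy) h4]
  have h2 := one_div_le_one_div_of_le hB (rampFactor_antitone hp hx0 hxy)
  have h4 : 0 ≤ (3 - 4 * y) / (y * (p - y)) := by positivity
  have h5 : 0 ≤ 1 / rampFactor p x :=
    one_div_nonneg.2 (hB.le.trans (rampFactor_antitone hp hx0 hxy))
  gcongr

/-- The admissible parameters of a needle: the window `[p - w, p]` lies in `[3/5, 2/3]`. -/
structure NeedleParams (p w : ℝ) : Prop where
  pos : 0 < w
  left : 3 / 5 ≤ p - w
  right : p ≤ 2 / 3

theorem NeedleParams.le {p w : ℝ} (h : NeedleParams p w) : 3 / 5 ≤ p := by linarith [h.pos, h.left]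

theorem NeedleParams.half_lt {p w : ℝ} (h : NeedleParams p w) : 1 / 2 < p := by linarith [h.le]

theorem one_sub_rampCDF_le {p w : ℝ} (h : NeedleParams p w) {x : ℝ} (hx : 3 / 5 ≤ x) (hxp : x ≤ p) :
    1 - rampCDF p x ≤ 11 * (p - x) := by
  have hp := h.le
  have hp' := h.right
  rw [one_sub_rampCDF h.half_lt (by linarith), div_le_iff₀ (by
    have : 0 < 2 * p - 1 := by linarith
    positivity)]
  have h1 := rampFactor_le h.half_lt (show 0 < x by linarith)
  have h2 : (27 / 125 : ℝ) ≤ x ^ 3 := by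
    calc (27 / 125 : ℝ) = (3 / 5) ^ 3 := by norm_num
      _ ≤ x ^ 3 := by gcongr
  have h3 : (1 / 5 : ℝ) * (27 / 125) ≤ (2 * p - 1) * x ^ 3 := by
    have : (1 / 5 : ℝ) ≤ 2 * p - 1 := by linarith
    gcongr
  have h4 : rampFactor p x ≤ 11 * ((2 * p - 1) * x ^ 3) := by nlinarith
  nlinarith [mul_le_mul_of_nonneg_left h4 (sub_nonneg.2 hxp)]

theorem rampMass_le {p w : ℝ} (h : NeedleParams p w) : rampMass p w ≤ 11 * w := by
  have := one_sub_rampCDF_le h h.left (by linarith [h.pos])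
  unfold rampMass
  linarith

theorem le_rampMass {p w : ℝ} (h : NeedleParams p w) : w ≤ rampMass p w := by
  have hp := h.le
  have hp' := h.right
  have hw := h.pos
  have hl := h.left
  have hx : 0 < p - w := by linarith
  have h1 : 0 < 2 * p - 1 := by linarith
  rw [rampMass, one_sub_rampCDF h.half_lt hx, le_div_iff₀ (by positivity), sub_sub_cancel]
  have h2 := le_rampFactor h.half_lt hp' hx (by linarith)
  have h3 : (p - w) ^ 3 ≤ p ^ 3 := by gcongr; linarith
  have h4 : (2 * p - 1) * (p - w) ^ 3 ≤ 1 / 3 * p ^ 3 := by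
    gcongr; linarith
  have h5 : p ^ 3 ≤ p ^ 2 := pow_le_pow_of_le_one (by linarith) (by linarith) (by norm_num)
  have h6 : (2 * p - 1) * (p - w) ^ 3 ≤ rampFactor p (p - w) := by linarith
  exact mul_le_mul_of_nonneg_left h6 hw.le

theorem rampMass_pos {p w : ℝ} (h : NeedleParams p w) : 0 < rampMass p w := h.pos.trans_le (le_rampMass h)

theorem ramp_hazard_left_le {p w : ℝ} (h : NeedleParams p w) :
    rampDensity p (p - w) / (1 - rampCDF p (p - w)) ≤ 7 / w := by
  have hp := h.le
  have hp' := h.right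
  have hw := h.pos
  have hl := h.left
  have hx : 0 < p - w := by linarith
  have h2 := le_rampFactor h.half_lt hp' hx (by linarith)
  have hB : 0 < rampFactor p (p - w) := lt_of_lt_of_le (by positivity) h2
  rw [ramp_hazard h.half_lt hp' hx (by linarith), sub_sub_cancel]
  have e : p ^ 3 * ((3 - 4 * (p - w)) / ((p - w) * w)) * (1 / rampFactor p (p - w))
      = p ^ 3 * (3 - 4 * (p - w)) / ((p - w) * rampFactor p (p - w)) / w := by
    field_simp
  rw [e]
  gcongr
  rw [div_le_iff₀ (by positivity)]
  have h3 : p ^ 3 * (3 - 4 * (p - w)) ≤ p ^ 2 * (3 / 5) := by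
    have : p ^ 3 ≤ p ^ 2 := pow_le_pow_of_le_one (by linarith) (by linarith) (by norm_num)
    have h0 : 0 ≤ 3 - 4 * (p - w) := by linarith
    calc p ^ 3 * (3 - 4 * (p - w)) ≤ p ^ 2 * (3 - 4 * (p - w)) := by gcongr
      _ ≤ p ^ 2 * (3 / 5) := by gcongr; linarith
  have h4 : 3 / 5 * (p ^ 2 / 3) ≤ (p - w) * rampFactor p (p - w) := by gcongr
  nlinarith [sq_nonneg p]

theorem hasDerivAt_tailCDF {p w : ℝ} (x : ℝ) :
    HasDerivAt (tailCDF p w) (7 / w * (1 - tailCDF p w x)) x := by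
  have h1 : HasDerivAt (fun x : ℝ => -(7 / w) * (x - (p - w))) (-(7 / w)) x := by
    simpa using ((hasDerivAt_id x).sub_const (p - w)).const_mul (-(7 / w))
  have h2 := ((h1.exp).const_mul (rampMass p w)).const_sub 1
  refine h2.congr_deriv ?_
  unfold tailCDF
  ring

theorem tailCDF_lt_one {p w : ℝ} (h : NeedleParams p w) (x : ℝ) : tailCDF p w x < 1 := by
  have := mul_pos (rampMass_pos h) (Real.exp_pos (-(7 / w) * (x - (p - w))))
  unfold tailCDF
  linarith

theorem tailCDF_left {p w : ℝ} : tailCDF p w (p - w) = rampCDF p (p - w) := by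
  simp [tailCDF, rampMass]

theorem one_sub_tailCDF_le {p w : ℝ} (h : NeedleParams p w) {x : ℝ} (hx : p - w ≤ x) : 1 - tailCDF p w x ≤ 11 * w := by
  have h1 : Real.exp (-(7 / w) * (x - (p - w))) ≤ 1 := by
    rw [Real.exp_le_one_iff, neg_mul, neg_nonpos]
    exact mul_nonneg (by have := h.pos; positivity) (by linarith)
  have h2 := mul_le_of_le_one_right (rampMass_pos h).le h1
  have := rampMass_le h
  unfold tailCDF
  linarith

theorem lt_one_sub_tailCDF_right {p w : ℝ} (h : NeedleParams p w) : w / 2187 < 1 - tailCDF p w p := by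
  have hw := h.pos
  have h1 : 1 - tailCDF p w p = rampMass p w * Real.exp (-7) := by
    unfold tailCDF
    have : -(7 / w) * (p - (p - w)) = -7 := by field_simp; ring
    rw [this]
    ring
  have h2 : Real.exp 7 < 2187 := by
    have : Real.exp 7 = Real.exp 1 ^ 7 := by rw [← Real.exp_nat_mul]; norm_num
    rw [this]
    calc Real.exp 1 ^ 7 < 3 ^ 7 := by
          gcongr; linarith [Real.exp_one_lt_d9]
      _ = 2187 := by norm_num
  rw [h1, Real.exp_neg, ← div_eq_mul_inv]
  have := le_rampMass h
  calc w / 2187 < w / Real.exp 7 := by gcongr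
    _ ≤ _ := by gcongr

/-! ### The buyers of the hard instances -/

theorem hasRightDensity_zero (a c : ℝ) : HasRightDensity a c (fun _ => 0) fun _ => 0 :=
  .of_hasDerivAt (fun _ _ => hasDerivAt_const _ _) fun _ _ => le_rfl

theorem hasDerivAt_flatCDF {x : ℝ} (hx : 0 < x) : HasDerivAt flatCDF (1 / (2 * x ^ 2)) x := by
  have h1 : HasDerivAt (fun x : ℝ => 2 * x) 2 x := by simpa using (hasDerivAt_id x).const_mul 2
  have h2 := ((hasDerivAt_const x (1 : ℝ)).div h1 (by positivity)).const_sub 1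
  refine h2.congr_deriv ?_
  field_simp
  ring

theorem hasDerivAt_flatFactor {x : ℝ} (hx : 0 < x) :
    HasDerivAt flatFactor ((2 - 2 * x) / x ^ 3) x := by
  have h1 : HasDerivAt (fun x : ℝ => 2 * x - 1) 2 x := by
    simpa using ((hasDerivAt_id x).const_mul 2).sub_const 1
  have h2 := h1.div (hasDerivAt_pow 2 x) (by positivity)
  refine h2.congr_deriv ?_
  field_simp
  simp
  ring

theorem one_sub_flatFactor {x : ℝ} (hx : 0 < x) : 1 - flatFactor x = (1 - x) ^ 2 / x ^ 2 := by
  unfold flatFactor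
  field_simp
  ring

theorem flatFactor_hazard {x : ℝ} (hx : 0 < x) (hx1 : x < 1) :
    (2 - 2 * x) / x ^ 3 / (1 - flatFactor x) = 2 / (x * (1 - x)) := by
  have : 0 < 1 - x := by linarith
  rw [one_sub_flatFactor hx]
  field_simp

theorem hasRightDensity_flatCDF {a : ℝ} (ha : 1 / 2 ≤ a) :
    HasRightDensity a 1 flatCDF fun x => 1 / (2 * x ^ 2) :=
  .of_hasDerivAt (fun _ hx => hasDerivAt_flatCDF (by linarith [hx.1])) fun _ _ => by positivity

theorem hasRightDensity_flatFactor {a : ℝ} (ha : 1 / 2 ≤ a) :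
    HasRightDensity a 1 flatFactor fun x => (2 - 2 * x) / x ^ 3 :=
  .of_hasDerivAt (fun _ hx => hasDerivAt_flatFactor (by linarith [hx.1])) fun x hx =>
    div_nonneg (by linarith [hx.2]) (by have : 0 < x := by linarith [hx.1]
                                        positivity)

theorem flatFactor_hazard_monotoneOn {a : ℝ} (ha : 1 / 2 ≤ a) :
    MonotoneOn (fun x => (2 - 2 * x) / x ^ 3 / (1 - flatFactor x)) (Ico a 1) := by
  intro x hx y hy hxy
  have hx0 : 0 < x := by linarith [hx.1]
  have hy0 : 0 < y := by linarith
  have hy1 : 0 < 1 - y := by linarith [hy.2]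
  simp only [flatFactor_hazard hx0 hx.2, flatFactor_hazard hy0 hy.2]
  have : y * (1 - y) ≤ x * (1 - x) := by nlinarith [hx.1]
  gcongr

theorem flatCDF_lt_one {x : ℝ} (hx : 0 < x) : flatCDF x < 1 := by
  have : 0 < 1 / (2 * x) := by positivity
  unfold flatCDF
  linarith

theorem flatFactor_lt_one {x : ℝ} (hx : 0 < x) (hx1 : x < 1) : flatFactor x < 1 := by
  have h1 : 0 < 1 - x := by linarith
  have : 0 < 1 - flatFactor x := by rw [one_sub_flatFactor hx]; positivity
  linarith

/-- A buyer who always bids `0`. -/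
theorem isProfile_zero : IsProfile 0 (fun _ => 0) fun _ => 0 where
  nonneg := le_rfl
  le_one := zero_le_one
  zero := rfl
  density := hasRightDensity_zero 0 0
  lt_one _ _ := zero_lt_one
  end_le := zero_le_one

theorem exists_mhr_zero : ∃ D ∈ mhrFamily, leftCDF D = cutCDF 0 fun _ => 0 :=
  isProfile_zero.exists_mem_mhrFamily fun _ hx => absurd hx.2 (not_lt.2 hx.1)

theorem exists_regular_flat :
    ∃ D ∈ regularFamily, leftCDF D = cutCDF 1 (glue (1 / 2) (fun _ => 0) flatCDF) := by
  have hp : IsProfile 1 (glue (1 / 2) (fun _ => 0) flatCDF)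
      (glue (1 / 2) (fun _ => 0) fun x => 1 / (2 * x ^ 2)) :=
    { nonneg := zero_le_one
      le_one := le_rfl
      zero := glue_of_lt _ _ (by norm_num)
      density := (hasRightDensity_zero 0 (1 / 2)).glue (by norm_num) (by norm_num)
        (hasRightDensity_flatCDF le_rfl) (by norm_num [flatCDF])
      lt_one := fun x hx => by
        rcases lt_or_ge x (1 / 2) with h | h
        · rw [glue_of_lt _ _ h]; exact zero_lt_one
        · rw [glue_of_le _ _ h]; exact flatCDF_lt_one (by linarith)
      end_le := by rw [glue_of_le _ _ (by norm_num)]; norm_num [flatCDF] }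
  refine hp.exists_mem_regularFamily fun x y hx hxy hy => ?_
  rcases lt_or_ge x (1 / 2) with h | h
  · left; exact glue_of_lt _ _ h
  · right
    have hx0 : 0 < x := by linarith
    have hy0 : 0 < y := by linarith
    rw [glue_of_le _ _ h, glue_of_le _ _ h, glue_of_le _ _ (h.trans hxy.le),
      glue_of_le _ _ (h.trans hxy.le)]
    refine ⟨by positivity, le_of_eq ?_⟩
    unfold flatCDF
    field_simp
    ring

theorem exists_mhr_flatFactor :
    ∃ D ∈ mhrFamily, leftCDF D = cutCDF 1 (glue (1 / 2) (fun _ => 0) flatFactor) := by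
  have hp : IsProfile 1 (glue (1 / 2) (fun _ => 0) flatFactor)
      (glue (1 / 2) (fun _ => 0) fun x => (2 - 2 * x) / x ^ 3) :=
    { nonneg := zero_le_one
      le_one := le_rfl
      zero := glue_of_lt _ _ (by norm_num)
      density := (hasRightDensity_zero 0 (1 / 2)).glue (by norm_num) (by norm_num)
        (hasRightDensity_flatFactor le_rfl) (by norm_num [flatFactor])
      lt_one := fun x hx => by
        rcases lt_or_ge x (1 / 2) with h | h
        · rw [glue_of_lt _ _ h]; exact zero_lt_one
        · rw [glue_of_le _ _ h]; exact flatFactor_lt_one (by linarith) hx.2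
      end_le := by rw [glue_of_le _ _ (by norm_num)]; norm_num [flatFactor] }
  refine hp.exists_mem_mhrFamily (MonotoneOn.glue_hazard ?_ (flatFactor_hazard_monotoneOn le_rfl)
    fun x hx => ?_)
  · intro x _ y _ _; simp
  · rw [flatFactor_hazard (by norm_num) (by norm_num)]
    norm_num

theorem exists_mhr_uniform : ∃ D ∈ mhrFamily, leftCDF D = cutCDF 1 fun x => x / 2 := by
  have hp : IsProfile 1 (fun x => x / 2) fun _ => 1 / 2 :=
    { nonneg := zero_le_one
      le_one := le_rfl
      zero := by norm_num
      density := .of_hasDerivAt (fun x _ => (hasDerivAt_id x).div_const 2) fun _ _ => by norm_num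
      lt_one := fun x hx => by linarith [hx.2]
      end_le := by norm_num }
  refine hp.exists_mem_mhrFamily fun x hx y hy hxy => ?_
  have : 0 < 1 - y / 2 := by linarith [hy.2]
  show 1 / 2 / (1 - x / 2) ≤ 1 / 2 / (1 - y / 2)
  gcongr

/-- The buyer that hides the needle, with an atom of order `w` at `p`. -/
theorem exists_mhr_needle {p w : ℝ} (h : NeedleParams p w) : ∃ D ∈ mhrFamily, leftCDF D
    = cutCDF p (glue (1 / 2) (fun _ => 0) (glue (p - w) (rampCDF p) (tailCDF p w))) := by
  have hp := h.le
  have hp' := h.right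
  have hw := h.pos
  have hl := h.left
  have hramp : HasRightDensity (1 / 2) (p - w) (rampCDF p) (rampDensity p) :=
    .of_hasDerivAt (fun x hx => hasDerivAt_rampCDF h.half_lt (by linarith [hx.1])) fun x hx => by
      have h1 : 0 ≤ 3 - 4 * x := by linarith [hx.2]
      have h2 : 0 < 2 * p - 1 := by linarith
      unfold rampDensity
      positivity
  have htail : HasRightDensity (p - w) p (tailCDF p w) fun x => 7 / w * (1 - tailCDF p w x) :=
    .of_hasDerivAt (fun x _ => hasDerivAt_tailCDF x) fun x _ =>
      mul_nonneg (by positivity) (sub_pos.2 (tailCDF_lt_one h x)).le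
  have hprof : IsProfile p (glue (1 / 2) (fun _ => 0) (glue (p - w) (rampCDF p) (tailCDF p w)))
      (glue (1 / 2) (fun _ => 0)
        (glue (p - w) (rampDensity p) fun x => 7 / w * (1 - tailCDF p w x))) :=
    { nonneg := by linarith
      le_one := by linarith
      zero := glue_of_lt _ _ (by norm_num)
      density := (hasRightDensity_zero 0 (1 / 2)).glue (by norm_num) (by linarith)
        (hramp.glue (by linarith) (by linarith) htail tailCDF_left.symm) (by
          rw [glue_of_lt _ _ (by linarith)]; norm_num [rampCDF])
      lt_one := fun x hx => by
        rcases lt_or_ge x (1 / 2) with h1 | h1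
        · rw [glue_of_lt _ _ h1]; exact zero_lt_one
        · rw [glue_of_le _ _ h1]
          rcases lt_or_ge x (p - w) with h2 | h2
          · rw [glue_of_lt _ _ h2]
            have h3 : 0 < 1 - rampCDF p x := by
              rw [one_sub_rampCDF h.half_lt (by linarith)]
              have h4 : 0 < rampFactor p x := lt_of_lt_of_le (by positivity)
                (le_rampFactor h.half_lt hp' (by linarith) hx.2.le)
              have h5 : 0 < 2 * p - 1 := by linarith
              have h6 : 0 < p - x := by linarith
              have h7 : 0 < x := by linarith
              positivity
            linarith
          · rw [glue_of_le _ _ h2]; exact tailCDF_lt_one h x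
      end_le := by
        rw [glue_of_le _ _ (by linarith), glue_of_le _ _ (by linarith)]
        exact (tailCDF_lt_one h p).le }
  have hconst : ∀ x, 7 / w * (1 - tailCDF p w x) / (1 - tailCDF p w x) = 7 / w := fun x =>
    mul_div_cancel_right₀ _ (sub_pos.2 (tailCDF_lt_one h x)).ne'
  refine hprof.exists_mem_mhrFamily (MonotoneOn.glue_hazard ?_
    (MonotoneOn.glue_hazard ?_ ?_ ?_) ?_)
  · intro x _ y _ _; simp
  · intro x hx y hy hxy
    exact ramp_hazard_monotone h.half_lt hp' hx.1 hxy (by linarith [hy.2])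
  · intro x _ y _ _
    simp only [hconst]
    exact le_rfl
  · intro x hx
    rw [hconst]
    exact (ramp_hazard_monotone h.half_lt hp' hx.1 hx.2.le (by linarith)).trans
      (ramp_hazard_left_le h)
  · intro x _
    rw [glue_of_lt _ _ (by linarith), glue_of_lt _ _ (by linarith)]
    have h1 : rampCDF p (1 / 2) = 0 := by norm_num [rampCDF]
    have h2 : 0 < 2 * p - 1 := by linarith
    have h3 : 0 ≤ rampDensity p (1 / 2) := by
      unfold rampDensity
      norm_num
      positivity
    rw [h1]
    simpa using h3

/-- The second of two regular buyers; the needle sits at the kink. -/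
theorem exists_regular_partner {p w : ℝ} (h : NeedleParams p w) : ∃ D ∈ regularFamily, leftCDF D
    = cutCDF 1 (glue p (fun x => (2 * p - 1) / (2 * p ^ 3) * x ^ 2) flatCDF) := by
  have hp := h.le
  have hp' := h.right
  set γ := (2 * p - 1) / (2 * p ^ 3) with hγ
  have hγ0 : 0 < γ := div_pos (by linarith) (by positivity)
  have hγp : γ * p ^ 2 = flatCDF p := by
    rw [hγ]; unfold flatCDF; field_simp
  have hγ3 : 3 * (γ * p ^ 2) ≤ 1 := by
    rw [hγp, flatCDF]
    have : 3 / 4 ≤ 1 / (2 * p) := by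
      rw [le_div_iff₀ (by positivity)]; linarith
    linarith
  have hquad : HasRightDensity 0 p (fun x => γ * x ^ 2) fun x => γ * (2 * x) :=
    .of_hasDerivAt (fun x _ => by simpa using (hasDerivAt_pow 2 x).const_mul γ) fun x hx => by
      have := hx.1
      positivity
  have hmono : ∀ x, 0 ≤ x → x ≤ p → γ * x ^ 2 ≤ γ * p ^ 2 := fun x h0 h1 => by gcongr
  have hprof : IsProfile 1 (glue p (fun x => γ * x ^ 2) flatCDF)
      (glue p (fun x => γ * (2 * x)) fun x => 1 / (2 * x ^ 2)) :=
    { nonneg := zero_le_one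
      le_one := le_rfl
      zero := by rw [glue_of_lt _ _ (by linarith)]; simp
      density := hquad.glue (by linarith) (by linarith) (hasRightDensity_flatCDF (by linarith)) hγp
      lt_one := fun x hx => by
        rcases lt_or_ge x p with h1 | h1
        · rw [glue_of_lt _ _ h1]; linarith [hmono x hx.1 h1.le]
        · rw [glue_of_le _ _ h1]; exact flatCDF_lt_one (by linarith)
      end_le := by rw [glue_of_le _ _ (by linarith)]; norm_num [flatCDF] }
  have hflat : ∀ x, 0 < x → x - (1 - flatCDF x) / (1 / (2 * x ^ 2)) = 0 := fun x hx => by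
    unfold flatCDF
    field_simp
    ring
  refine hprof.exists_mem_regularFamily fun x y hx hxy hy => ?_
  rcases lt_or_ge y p with h1 | h1
  · rw [glue_of_lt _ _ h1, glue_of_lt _ _ h1, glue_of_lt _ _ (hxy.trans h1),
      glue_of_lt _ _ (hxy.trans h1)]
    rcases hx.eq_or_lt with rfl | hx0
    · left; simp
    · right
      have hy0 : 0 < y := by linarith
      refine ⟨by positivity, ?_⟩
      have h2 := hmono y hy0.le h1.le
      have h3 : γ * x ^ 2 ≤ γ * y ^ 2 := by gcongr
      have h4 : (1 - γ * y ^ 2) / (γ * (2 * y)) ≤ (1 - γ * x ^ 2) / (γ * (2 * x)) := by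
        have : 0 ≤ 1 - γ * x ^ 2 := by linarith
        gcongr
      linarith
  · rw [glue_of_le _ _ h1, glue_of_le _ _ h1, hflat y (by linarith)]
    rcases lt_or_ge x p with h2 | h2
    · rw [glue_of_lt _ _ h2, glue_of_lt _ _ h2]
      rcases hx.eq_or_lt with rfl | hx0
      · left; simp
      · right
        refine ⟨by have : 0 < y := by linarith
                   positivity, ?_⟩
        rw [sub_nonpos, le_div_iff₀ (by positivity)]
        linarith [hmono x hx0.le h2.le]
    · right
      rw [glue_of_le _ _ h2, glue_of_le _ _ h2, hflat x (by linarith)]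
      exact ⟨by have : 0 < y := by linarith
                positivity, le_rfl⟩

/-- The second of three MHR buyers; the needle sits at the kink. -/
theorem exists_mhr_partner {p w : ℝ} (h : NeedleParams p w) : ∃ D ∈ mhrFamily, leftCDF D
    = cutCDF 1 (glue p (fun x => (2 * p - 1) / p ^ 3 * x) flatFactor) := by
  have hp := h.le
  have hp' := h.right
  have hp1 : 0 < 1 - p := by linarith
  set γ := (2 * p - 1) / p ^ 3 with hγ
  have hγ0 : 0 < γ := div_pos (by linarith) (by positivity)
  have hγp : γ * p = flatFactor p := by
    rw [hγ]; unfold flatFactor; field_simp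
  have hlt : ∀ x ≤ p, γ * x < 1 := fun x hx => by
    have h1 := flatFactor_lt_one (show 0 < p by linarith) (by linarith)
    have h2 : γ * x ≤ γ * p := by gcongr
    linarith
  have hlin : HasRightDensity 0 p (fun x => γ * x) fun _ => γ :=
    .of_hasDerivAt (fun x _ => by simpa using (hasDerivAt_id x).const_mul γ) fun _ _ => hγ0.le
  have hprof : IsProfile 1 (glue p (fun x => γ * x) flatFactor)
      (glue p (fun _ => γ) fun x => (2 - 2 * x) / x ^ 3) :=
    { nonneg := zero_le_one
      le_one := le_rfl
      zero := by rw [glue_of_lt _ _ (by linarith)]; simp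
      density := hlin.glue (by linarith) (by linarith)
        (hasRightDensity_flatFactor (by linarith)) hγp
      lt_one := fun x hx => by
        rcases lt_or_ge x p with h1 | h1
        · rw [glue_of_lt _ _ h1]; exact hlt x h1.le
        · rw [glue_of_le _ _ h1]; exact flatFactor_lt_one (by linarith) hx.2
      end_le := by rw [glue_of_le _ _ (by linarith)]; norm_num [flatFactor] }
  have hmono : ∀ x y, x ≤ y → y ≤ p → γ / (1 - γ * x) ≤ γ / (1 - γ * y) := fun x y hxy hy => by
    have := hlt y hy
    have h1 : 0 < 1 - γ * y := by linarith
    gcongr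
  refine hprof.exists_mem_mhrFamily (MonotoneOn.glue_hazard (fun x hx y hy hxy =>
    hmono x y hxy hy.2.le) (flatFactor_hazard_monotoneOn (by linarith)) fun x hx => ?_)
  refine (hmono x p hx.2.le le_rfl).trans ?_
  rw [flatFactor_hazard (by linarith) (by linarith), hγp, one_sub_flatFactor (by linarith), hγ]
  have e : (2 * p - 1) / p ^ 3 / ((1 - p) ^ 2 / p ^ 2) = (2 * p - 1) / (p * (1 - p) ^ 2) := by
    field_simp
  rw [e, div_le_div_iff₀ (by positivity) (by positivity)]
  nlinarith [mul_pos (show 0 < p by linarith) hp1, mul_pos hp1 hp1]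

/-! ### Lower bounds -/

theorem saleProb_eq_one_sub_prod {N : ℕ} (D : Fin N → ProbabilityMeasure ℝ) (p : I) :
    saleProb D p = 1 - ∏ i, leftCDF (D i) p := by
  have hcompl : {b : Fin N → ℝ | ∃ i, (p : ℝ) ≤ b i}
      = (Set.pi univ fun _ : Fin N => Iio (p : ℝ))ᶜ := by
    ext b
    simp [Set.mem_pi]
  have hm : MeasurableSet (Set.pi univ fun _ : Fin N => Iio (p : ℝ)) :=
    MeasurableSet.univ_pi fun _ => measurableSet_Iio
  rw [saleProb, hcompl, probReal_compl_eq_one_sub hm]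
  congr 1
  simp only [roundLaw, Measure.real, Measure.pi_pi, ENNReal.toReal_prod, leftCDF]

/-- The CDF of the maximal bid of the base instance; every price in `[1/2,1]` has revenue `1/2`. -/
def baseCDF (x : ℝ) : ℝ := glue (1 / 2) (fun _ => 0) flatCDF x

/-- The CDF of the maximal bid of the instance with a needle in the window `(p - w, p]`. -/
def needleCDF (p w x : ℝ) : ℝ :=
  if x ∈ Ioc (p - w) p then tailCDF p w x * ((2 * p - 1) / (2 * p ^ 3) * x ^ 2) else baseCDF x

/-- The family contains a base instance and all the needle instances with `N` buyers. -/
def HasNeedles (𝓓 : Set (ProbabilityMeasure ℝ)) (N : ℕ) : Prop :=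
  (∃ D ∈ Instances 𝓓 N, ∀ x : I, saleProb D x = 1 - baseCDF x) ∧
    ∀ p w, NeedleParams p w → ∃ D ∈ Instances 𝓓 N, ∀ x : I, saleProb D x = 1 - needleCDF p w x

theorem HasNeedles.mono {𝓓 𝓓' : Set (ProbabilityMeasure ℝ)} (hsub : 𝓓 ⊆ 𝓓') {N : ℕ}
    (h : HasNeedles 𝓓 N) : HasNeedles 𝓓' N := by
  obtain ⟨⟨D, hD, hD'⟩, h2⟩ := h
  refine ⟨⟨D, fun i => hsub (hD i), hD'⟩, fun p w hpw => ?_⟩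
  obtain ⟨E, hE, hE'⟩ := h2 p w hpw
  exact ⟨E, fun i => hsub (hE i), hE'⟩

theorem cutCDF_one {g : ℝ → ℝ} {x : ℝ} (hx : 0 < x) (hx1 : x ≤ 1) : cutCDF 1 g x = g x := by
  rw [cutCDF, if_neg (not_le.2 hx), if_pos hx1]

/-- Buyers who bid `0` do not matter. -/
theorem mul_prod_cutCDF_zero (a : ℝ) {e : ℝ} {g : ℝ → ℝ} (x : I) (n : ℕ) :
    cutCDF e g x * (a * ∏ _i : Fin n, cutCDF 0 (fun _ => 0) (x : ℝ)) = cutCDF e g x * a := by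
  rcases x.2.1.eq_or_lt with h | h
  · simp [cutCDF, ← h]
  · have : cutCDF 0 (fun _ => 0) (x : ℝ) = 1 := by
      rw [cutCDF, if_neg (not_le.2 h), if_neg (not_le.2 h)]
    simp [this]

theorem rampCDF_mul {p x : ℝ} (hp : 1 / 2 < p) (hx : 0 < x) :
    rampCDF p x * ((2 * p - 1) / (2 * p ^ 3) * x ^ 2) = flatCDF x := by
  have h1 : 0 < 2 * p - 1 := by linarith
  unfold rampCDF flatCDF
  have hp0 : 0 < p := by linarith
  field_simp

/-- The needle buyer, times anything that completes it to `flatCDF` outside the window. -/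
theorem needleBuyer_mul {p w : ℝ} (h : NeedleParams p w) {P : ℝ → ℝ}
    (hP : ∀ x, 1 / 2 ≤ x → x ≤ p → P x = (2 * p - 1) / (2 * p ^ 3) * x ^ 2)
    (hP' : ∀ x, p < x → x ≤ 1 → P x = flatCDF x) {x : ℝ} (hx : 0 < x) (hx1 : x ≤ 1) :
    cutCDF p (glue (1 / 2) (fun _ => 0) (glue (p - w) (rampCDF p) (tailCDF p w))) x * P x
      = needleCDF p w x := by
  have hp := h.le
  have hw := h.pos
  have hl := h.left
  rw [cutCDF, if_neg (not_le.2 hx), needleCDF]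
  rcases lt_or_ge p x with h1 | h1
  · rw [if_neg (not_le.2 h1), if_neg fun hm => absurd hm.2 (not_le.2 h1), one_mul, hP' x h1 hx1,
      baseCDF, glue_of_le _ _ (by linarith)]
  rw [if_pos h1]
  rcases lt_or_ge x (1 / 2) with h2 | h2
  · rw [if_neg fun hm => by linarith [hm.1], glue_of_lt _ _ h2, zero_mul, baseCDF,
      glue_of_lt _ _ h2]
  rw [glue_of_le _ _ h2, hP x h2 h1]
  rcases lt_trichotomy x (p - w) with h3 | h3 | h3
  · rw [if_neg fun hm => by linarith [hm.1], glue_of_lt _ _ h3, baseCDF, glue_of_le _ _ h2,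
      rampCDF_mul h.half_lt hx]
  · rw [if_neg fun hm => by linarith [hm.1], glue_of_le _ _ h3.ge, baseCDF, glue_of_le _ _ h2]
    subst h3
    rw [tailCDF_left, rampCDF_mul h.half_lt hx]
  · rw [if_pos ⟨h3, h1⟩, glue_of_le _ _ h3.le]

/-- With two regular buyers, the needle buyer and its partner multiply to `flatCDF` outside the
window; the partner has CDF `γ x²` before the kink at `p` and `flatCDF` after it. -/
theorem hasNeedles_regular {N : ℕ} (hN : 2 ≤ N) : HasNeedles regularFamily N := by
  obtain ⟨n, rfl⟩ := Nat.exists_eq_add_of_le' hN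
  obtain ⟨O, hO, hOF⟩ := exists_mhr_zero
  replace hO := mhrFamily_subset_regularFamily hO
  constructor
  · obtain ⟨A, hA, hAF⟩ := exists_regular_flat
    refine ⟨Fin.cons A fun _ => O, fun i => ?_, fun x => ?_⟩
    · refine Fin.cases ?_ (fun i => ?_) i
      · exact hA
      · exact hO
    · rw [saleProb_eq_one_sub_prod, Fin.prod_univ_succ]
      simp only [Fin.cons_zero, Fin.cons_succ, hAF, hOF]
      have := mul_prod_cutCDF_zero 1 (e := 1) (g := glue (1 / 2) (fun _ => 0) flatCDF) x (n + 1)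
      rw [one_mul, mul_one] at this
      rw [this]
      rcases x.2.1.eq_or_lt with h | h
      · rw [← h, baseCDF, glue_of_lt _ _ (by norm_num)]
        simp [cutCDF]
      · rw [cutCDF_one h x.2.2, baseCDF]
  · intro p w h
    obtain ⟨A, hA, hAF⟩ := exists_mhr_needle h
    obtain ⟨B, hB, hBF⟩ := exists_regular_partner h
    refine ⟨Fin.cons A (Fin.cons B fun _ => O), fun i => ?_, fun x => ?_⟩
    · refine Fin.cases ?_ (fun i => Fin.cases ?_ (fun i => ?_) i) i
      · exact mhrFamily_subset_regularFamily hA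
      · exact hB
      · exact hO
    · rw [saleProb_eq_one_sub_prod, Fin.prod_univ_succ, Fin.prod_univ_succ]
      simp only [Fin.cons_zero, Fin.cons_succ, hAF, hBF, hOF]
      rw [mul_prod_cutCDF_zero]
      congr 1
      have hp := h.le
      have hp' := h.right
      rcases x.2.1.eq_or_lt with hx | hx
      · rw [← hx, needleCDF, if_neg fun hm => by linarith [hm.1, h.left], baseCDF,
          glue_of_lt _ _ (by norm_num)]
        simp [cutCDF]
      · rw [cutCDF_one (g := glue p _ _) hx x.2.2]
        refine needleBuyer_mul h (P := glue p (fun x => (2 * p - 1) / (2 * p ^ 3) * x ^ 2) flatCDF)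
          (fun y _ hyp => ?_) (fun y hyp _ => glue_of_le _ _ hyp.le) hx x.2.2
        rcases hyp.lt_or_eq with h1 | rfl
        · exact glue_of_lt _ _ h1
        · rw [glue_of_le _ _ le_rfl]
          have : 0 < y := by linarith
          unfold flatCDF
          field_simp

theorem flatFactor_mul {x : ℝ} (hx : 0 < x) : flatFactor x * (x / 2) = flatCDF x := by
  unfold flatFactor flatCDF
  field_simp

/-- The CDF `flatCDF` is not MHR, but it is the product of the MHR CDFs `flatFactor` and `x / 2`,
which is why the MHR family needs a third buyer. -/
theorem hasNeedles_mhr {N : ℕ} (hN : 3 ≤ N) : HasNeedles mhrFamily N := by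
  obtain ⟨n, rfl⟩ := Nat.exists_eq_add_of_le' hN
  obtain ⟨O, hO, hOF⟩ := exists_mhr_zero
  obtain ⟨U, hU, hUF⟩ := exists_mhr_uniform
  constructor
  · obtain ⟨A, hA, hAF⟩ := exists_mhr_flatFactor
    refine ⟨Fin.cons A (Fin.cons U fun _ => O), fun i => ?_, fun x => ?_⟩
    · refine Fin.cases ?_ (fun i => Fin.cases ?_ (fun i => ?_) i) i
      · exact hA
      · exact hU
      · exact hO
    · rw [saleProb_eq_one_sub_prod, Fin.prod_univ_succ, Fin.prod_univ_succ]
      simp only [Fin.cons_zero, Fin.cons_succ, hAF, hUF, hOF]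
      rw [mul_prod_cutCDF_zero]
      congr 1
      rcases x.2.1.eq_or_lt with hx | hx
      · rw [← hx, baseCDF, glue_of_lt _ _ (by norm_num)]
        simp [cutCDF]
      · rw [cutCDF_one hx x.2.2, cutCDF_one hx x.2.2, baseCDF]
        rcases lt_or_ge (x : ℝ) (1 / 2) with h1 | h1
        · rw [glue_of_lt _ _ h1, glue_of_lt _ _ h1, zero_mul]
        · rw [glue_of_le _ _ h1, glue_of_le _ _ h1, flatFactor_mul hx]
  · intro p w h
    obtain ⟨A, hA, hAF⟩ := exists_mhr_needle h
    obtain ⟨B, hB, hBF⟩ := exists_mhr_partner h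
    refine ⟨Fin.cons A (Fin.cons B (Fin.cons U fun _ => O)), fun i => ?_, fun x => ?_⟩
    · refine Fin.cases ?_ (fun i => Fin.cases ?_ (fun i => Fin.cases ?_ (fun i => ?_) i) i) i
      · exact hA
      · exact hB
      · exact hU
      · exact hO
    · rw [saleProb_eq_one_sub_prod, Fin.prod_univ_succ, Fin.prod_univ_succ, Fin.prod_univ_succ]
      simp only [Fin.cons_zero, Fin.cons_succ, hAF, hBF, hUF, hOF]
      rw [← mul_assoc (cutCDF 1 _ _) (cutCDF 1 _ _), mul_prod_cutCDF_zero]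
      congr 1
      have hp := h.le
      have hp' := h.right
      rcases x.2.1.eq_or_lt with hx | hx
      · rw [← hx, needleCDF, if_neg fun hm => by linarith [hm.1, h.left], baseCDF,
          glue_of_lt _ _ (by norm_num)]
        simp [cutCDF]
      · rw [cutCDF_one (g := glue p _ _) hx x.2.2, cutCDF_one (g := fun x => x / 2) hx x.2.2]
        refine needleBuyer_mul h
          (P := fun x => glue p (fun x => (2 * p - 1) / p ^ 3 * x) flatFactor x * (x / 2))
          (fun y _ hyp => ?_) (fun y hyp _ => ?_) hx x.2.2
        · rcases hyp.lt_or_eq with h1 | rfl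
          · rw [glue_of_lt _ _ h1]
            ring
          · have : 0 < y := by linarith
            rw [glue_of_le _ _ le_rfl]
            unfold flatFactor
            field_simp
        · rw [glue_of_le _ _ hyp.le, flatFactor_mul (by linarith)]

theorem mul_one_sub_baseCDF_le (x : ℝ) : x * (1 - baseCDF x) ≤ 1 / 2 := by
  rcases lt_or_ge x (1 / 2) with h | h
  · rw [baseCDF, glue_of_lt _ _ h]; linarith
  · have hx0 : 0 < x := by linarith
    rw [baseCDF, glue_of_le _ _ h]
    unfold flatCDF
    refine le_of_eq ?_
    field_simp
    ring

/-- Inside the window the needle changes the feedback law by `O(w)`. -/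
theorem needleCDF_close {p w x : ℝ} (h : NeedleParams p w) (hw : w ≤ 1 / 1000)
    (hx : x ∈ Ioc (p - w) p) :
    0 < 1 - needleCDF p w x ∧ 1 - needleCDF p w x < 1 ∧
      ((1 - baseCDF x) - (1 - needleCDF p w x)) ^ 2
        ≤ 200 * w ^ 2 * ((1 - needleCDF p w x) * (1 - (1 - needleCDF p w x))) := by
  have hw0 := h.pos
  have hp := h.le
  have hp' := h.right
  have hl := h.left
  have hx0 : 0 < x := by linarith [hx.1]
  have hxl : 3 / 5 ≤ x := by linarith [hx.1]
  have hb : baseCDF x = rampCDF p x * ((2 * p - 1) / (2 * p ^ 3) * x ^ 2) := by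
    rw [baseCDF, glue_of_le _ _ (by linarith), rampCDF_mul h.half_lt hx0]
  have hb2 : baseCDF x = 1 - 1 / (2 * x) := by
    rw [baseCDF, glue_of_le _ _ (by linarith), flatCDF]
  rw [needleCDF, if_pos hx, hb]
  have ht := tailCDF_lt_one h x
  have ht' := one_sub_tailCDF_le h hx.1.le
  have hr' := one_sub_rampCDF_le h hxl hx.2
  have hr : rampCDF p x ≤ 1 := by
    have h1 : 0 ≤ 1 - rampCDF p x := by
      rw [one_sub_rampCDF h.half_lt hx0]
      have h4 : 0 < rampFactor p x := lt_of_lt_of_le (by positivity)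
        (le_rampFactor h.half_lt hp' hx0 hx.2)
      have h5 : 0 < 2 * p - 1 := by linarith
      have h6 : 0 ≤ p - x := by linarith [hx.2]
      positivity
    linarith
  set s := (2 * p - 1) / (2 * p ^ 3) * x ^ 2 with hs
  have hs0 : 0 ≤ s := mul_nonneg (div_nonneg (by linarith) (by positivity)) (by positivity)
  have hs1 : s ≤ 1 / 4 := by
    have h1 : s ≤ (2 * p - 1) / (2 * p ^ 3) * p ^ 2 := by
      rw [hs]
      have h2 : 0 ≤ 2 * p - 1 := by linarith
      have h3 := hx.2
      gcongr
    have h2 : (2 * p - 1) / (2 * p ^ 3) * p ^ 2 = 1 - 1 / (2 * p) := by field_simp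
    have h3 : 3 / 4 ≤ 1 / (2 * p) := by
      rw [le_div_iff₀ (by positivity)]; linarith
    linarith
  have hs2 : 1 / 6 ≤ s := by
    have h1 : 1 / (2 * x) ≤ 5 / 6 := by
      rw [div_le_iff₀ (by positivity)]; linarith
    have h2 : rampCDF p x * s ≤ s := mul_le_of_le_one_left hs0 hr
    rw [hb] at hb2
    linarith
  set τ := tailCDF p w x with hτ
  set ρ := rampCDF p x with hρ
  have hτ0 : 9 / 10 ≤ τ := by linarith
  have h1 : 3 / 20 ≤ τ * s := by nlinarith
  have h2 : τ * s ≤ 1 / 4 := by nlinarith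
  refine ⟨by linarith, by linarith, ?_⟩
  have h3 : |τ - ρ| ≤ 11 * w := by
    rw [abs_le]; constructor <;> linarith [hx.1]
  have h4 : (τ - ρ) ^ 2 ≤ (11 * w) ^ 2 := by
    rw [← sq_abs]; gcongr
  have h5 : ((1 - ρ * s) - (1 - τ * s)) ^ 2 = (τ - ρ) ^ 2 * s ^ 2 := by ring
  have h6 : s ^ 2 ≤ 1 / 16 := by nlinarith
  have h7 : (τ - ρ) ^ 2 * s ^ 2 ≤ (11 * w) ^ 2 * (1 / 16) := by gcongr
  have h8 : 9 / 80 ≤ (1 - τ * s) * (1 - (1 - τ * s)) := by nlinarith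
  rw [h5]
  nlinarith [sq_nonneg w, mul_le_mul_of_nonneg_left h8 (show 0 ≤ 200 * w ^ 2 by positivity)]

/-- A price that is nearly optimal for a needle instance lies in its window: the revenue at `p`
exceeds `1 / 2` by more than `w / 21870 > ε`, and it is at most `1 / 2` outside the window. -/
theorem mem_window_of_near_optimal {N : ℕ} {D : Fin N → ProbabilityMeasure ℝ} {p w : ℝ}
    (h : NeedleParams p w) (hD : ∀ x : I, saleProb D x = 1 - needleCDF p w x) {ε : ℝ}
    (hε : 30000 * ε = w) {x : I} (hx : |revenue D x - optRevenue D| ≤ ε) :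
    (x : ℝ) ∈ Ioc (p - w) p := by
  by_contra hn
  have hp := h.le
  have hp' := h.right
  have h1 : revenue D x ≤ 1 / 2 := by
    rw [revenue_eq, hD, needleCDF, if_neg hn]
    exact mul_one_sub_baseCDF_le x
  have h2 := revenue_le_optRevenue D ⟨p, by linarith, by linarith⟩
  have hpw : p ∈ Ioc (p - w) p := ⟨by linarith [h.pos], le_rfl⟩
  rw [revenue_eq, hD, needleCDF, if_pos hpw] at h2
  have h3 : p * (1 - tailCDF p w p * ((2 * p - 1) / (2 * p ^ 3) * p ^ 2))
      = 1 / 2 + (1 - tailCDF p w p) * (p - 1 / 2) := by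
    field_simp
    ring
  have h4 := lt_one_sub_tailCDF_right h
  have h5 : w / 2187 * (1 / 10) ≤ (1 - tailCDF p w p) * (p - 1 / 2) := by
    have hw := h.pos
    exact mul_le_mul h4.le (by linarith) (by norm_num) ((by positivity : 0 ≤ w / 2187).trans h4.le)
  have h6 := (abs_le.1 hx).1
  have h7 : ε < w / 2187 * (1 / 10) := by linarith [h.pos]
  simp only at h2
  linarith

/-- Needles of height `ε` fit into windows of width `w = O(ε)`, so that there are `Ω(1/ε)` windows,
and each of them takes `Ω(1/w²)` queries to inspect. -/
theorem le_queryComplexity {𝓓 : Set (ProbabilityMeasure ℝ)} {N : ℕ} (h : HasNeedles 𝓓 N) {ε : ℝ}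
    (hε : 0 < ε) (hε' : ε ≤ 1 / 30000000) :
    ENNReal.ofReal (1 / (27 * 10 ^ 18) / ε ^ 3) ≤ queryComplexity 𝓓 N ε := by
  obtain ⟨⟨D, -, hD⟩, hneedle⟩ := h
  refine le_iInf₂ fun A hA => ?_
  by_contra hlt
  rw [not_le] at hlt
  set n : ℝ := 1 / (27 * 10 ^ 18) / ε ^ 3 with hn
  have hn0 : 0 ≤ n := by positivity
  set w : ℝ := 30000 * ε with hw
  have hw0 : 0 < w := by positivity
  have hw1 : w ≤ 1 / 1000 := by linarith
  set K : ℕ := ⌊1 / (15 * w)⌋₊ with hK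
  have hKle : (K : ℝ) ≤ 1 / (15 * w) := Nat.floor_le (by positivity)
  have hKge : 1 / (15 * w) < K + 1 := Nat.lt_floor_add_one _
  -- The windows are the `K` consecutive intervals of length `w` from `3 / 5` on.
  have hparam : ∀ j : Fin K, NeedleParams (3 / 5 + (j + 1) * w) w := by
    intro j
    have hj : ((j : ℝ) + 1) ≤ K := by exact_mod_cast j.2
    have hj' : ((j : ℝ) + 1) * w ≤ 1 / 15 := by
      calc ((j : ℝ) + 1) * w ≤ 1 / (15 * w) * w := by gcongr; exact hj.trans hKle
        _ = 1 / 15 := by field_simp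
    have h0 : 0 ≤ (j : ℝ) * w := by positivity
    exact ⟨hw0, by linarith, by linarith⟩
  choose D' hD'mem hD' using fun j => hneedle _ _ (hparam j)
  set W : Fin K → Set I := fun j =>
    {x | (x : ℝ) ∈ Ioc (3 / 5 + (j + 1) * w - w) (3 / 5 + (j + 1) * w)} with hWdef
  have hWm : ∀ j, MeasurableSet (W j) := fun j => measurable_subtype_coe measurableSet_Ioc
  have hdisj : Pairwise (Function.onFun Disjoint W) := by
    intro i j hij
    refine Set.disjoint_left.2 fun x hi hj => ?_
    have hi1 : 3 / 5 + ((i : ℝ) + 1) * w - w < x := hi.1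
    have hi2 : (x : ℝ) ≤ 3 / 5 + ((i : ℝ) + 1) * w := hi.2
    have hj1 : 3 / 5 + ((j : ℝ) + 1) * w - w < x := hj.1
    have hj2 : (x : ℝ) ≤ 3 / 5 + ((j : ℝ) + 1) * w := hj.2
    rcases lt_or_gt_of_ne (fun e => hij (Fin.ext e) : (i : ℕ) ≠ j) with hlt' | hlt'
    · have : ((i : ℝ) + 1) * w ≤ j * w := by
        gcongr; exact_mod_cast hlt'
      linarith
    · have : ((j : ℝ) + 1) * w ≤ i * w := by
        gcongr; exact_mod_cast hlt'
      linarith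
  obtain ⟨T, hT0, hT1, hT2⟩ : ∃ T : ℕ, 0 < T ∧ 100 * n ≤ T ∧ (T : ℝ) ≤ 100 * n + 2 := by
    have h1 := Nat.le_ceil (100 * n)
    have h2 := (Nat.ceil_lt_add_one (show 0 ≤ 100 * n by positivity)).le
    refine ⟨⌈100 * n⌉₊ + 1, Nat.succ_pos _, ?_, ?_⟩ <;> push_cast <;> linarith
  have key := card_le_of_solves_needles A D D' W hWm hdisj (β := 200 * w ^ 2) (by positivity)
    (fun j x hx => by
      have hx' : (x : ℝ) ∉ Ioc (3 / 5 + ((j : ℝ) + 1) * w - w) (3 / 5 + (j + 1) * w) := hx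
      rw [hD', hD, needleCDF, if_neg hx'])
    (fun j x hx => by
      rw [hD', hD]
      exact needleCDF_close (hparam j) hw1 hx)
    (fun j x hx => mem_window_of_near_optimal (hparam j) (hD' j) hw.symm hx)
    (fun j => hA (D' j) (hD'mem j)) hn0
    (fun j => (le_iSup₂_of_le (D' j) (hD'mem j) le_rfl).trans hlt.le) hT0 hT1
  -- With `y = 1 / w` the bound reads `0.94 (y / 15 - 1) < 2 + 400 (10⁻⁴ y + 2 w²)`, with `y ≥ 1000`.
  have hnw : w ^ 2 * n = 1 / 1000000 * (1 / w) := by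
    rw [hn, hw]
    field_simp
    norm_num
  have hy : 1000 ≤ 1 / w := by
    rw [le_div_iff₀ hw0]; linarith
  have h15 : 1 / (15 * w) = 1 / 15 * (1 / w) := by field_simp
  rw [h15] at hKge
  have hTw : w ^ 2 * T ≤ 1 / 10000 * (1 / w) + 1 / 100 := by
    have h1 : w ^ 2 * T ≤ w ^ 2 * (100 * n + 2) := by gcongr
    have h2 : w ^ 2 ≤ 1 / 1000 := by nlinarith
    nlinarith
  norm_num at key
  nlinarith

/-- A policy with smaller regret would be converted into an algorithm that beats the lower bound
for the query complexity. -/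
theorem le_minimaxRegret {𝓓 : Set (ProbabilityMeasure ℝ)} {N : ℕ} (h : HasNeedles 𝓓 N) {T : ℕ}
    (hT : 0 < T) :
    ((1 / (27 * 10 ^ 18) * (T : ℝ) ^ (2 / 3 : ℝ) : ℝ) : EReal) ≤ minimaxRegret 𝓓 N T := by
  have : NeZero T := ⟨hT.ne'⟩
  have hT' : (1 : ℝ) ≤ T := by exact_mod_cast hT
  refine le_iInf fun A => ?_
  by_contra hlt
  rw [not_le] at hlt
  set c : ℝ := 1 / (27 * 10 ^ 18) with hc
  have hc0 : 0 < c := by positivity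
  set s : ℝ := (T : ℝ) ^ (1 / 3 : ℝ) with hs
  have hs1 : 1 ≤ s := Real.one_le_rpow hT' (by norm_num)
  have hs3 : s ^ 3 = T := by
    rw [hs, ← Real.rpow_natCast, ← Real.rpow_mul (by positivity)]
    norm_num
  have hs2 : (T : ℝ) ^ (2 / 3 : ℝ) = s ^ 2 := by
    rw [hs, ← Real.rpow_natCast, ← Real.rpow_mul (by positivity)]
    norm_num
  have hreg : ∀ D ∈ Instances 𝓓 N, A.regret D T ≤ c * s ^ 2 := by
    intro D hD
    have h1 := (le_iSup₂_of_le (f := fun D (_ : D ∈ Instances 𝓓 N) => (A.regret D T : EReal))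
      D hD le_rfl).trans hlt.le
    rw [hs2] at h1
    exact EReal.coe_le_coe_iff.1 h1
  -- The accuracy at which online-to-batch conversion turns this policy into an algorithm.
  set ε : ℝ := 20 * c / s with hε
  have hε0 : 0 < ε := by positivity
  have hε1 : ε ≤ 1 / 30000000 := by
    rw [hε, div_le_iff₀ (by positivity), hc]
    norm_num
    linarith
  have h1 := sureQueryComplexity_le_of_regret_le A T 𝓓 hε0 (N := N) fun D hD =>
    (hreg D hD).trans (le_of_eq (by rw [hε, ← hs3]; field_simp; norm_num))
  have h2 := (le_queryComplexity h hε0 hε1).trans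
    ((queryComplexity_le_sureQueryComplexity 𝓓 N ε).trans h1)
  rw [← ENNReal.ofReal_natCast, ENNReal.ofReal_le_ofReal_iff (by positivity), ← hs3, ← hc,
    div_le_iff₀ (by positivity), hε] at h2
  have h3 : s ^ 3 * (20 * c / s) ^ 3 = 8000 * c ^ 3 := by
    field_simp
    norm_num
  rw [h3, hc] at h2
  norm_num at h2

end UniformPricing

end

theorem theorem1 :
    ∃ c C ε₀ : ℝ, ∃ T₀ : ℕ, 0 < c ∧ 0 < C ∧ 0 < ε₀ ∧
      ∀ (𝓓 : Set (ProbabilityMeasure ℝ)) (N : ℕ),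
        (𝓓 = UniformPricing.regularFamily ∧ 2 ≤ N) ∨
          (𝓓 = UniformPricing.mhrFamily ∧ 3 ≤ N) ∨
          (𝓓 = UniformPricing.generalFamily ∧ 2 ≤ N) →
        (∀ ε : ℝ, 0 < ε → ε ≤ ε₀ →
          ENNReal.ofReal (c / ε ^ 3) ≤ UniformPricing.queryComplexity 𝓓 N ε ∧
          UniformPricing.queryComplexity 𝓓 N ε ≤ ENNReal.ofReal (C / ε ^ 3) ∧
          ENNReal.ofReal (c / ε ^ 3) ≤ UniformPricing.sureQueryComplexity 𝓓 N ε ∧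
          UniformPricing.sureQueryComplexity 𝓓 N ε ≤ ENNReal.ofReal (C / ε ^ 3)) ∧
        (∀ T : ℕ, T₀ ≤ T →
          ((c * (T : ℝ) ^ (2 / 3 : ℝ) : ℝ) : EReal) ≤ UniformPricing.minimaxRegret 𝓓 N T ∧
          UniformPricing.minimaxRegret 𝓓 N T ≤ ((C * (T : ℝ) ^ (2 / 3 : ℝ) : ℝ) : EReal)) := by
  refine ⟨1 / (27 * 10 ^ 18), 141 ^ 3, 1 / 30000000, 1, by positivity, by positivity,
    by positivity, fun 𝓓 N h𝓓 => ?_⟩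
  have hn : UniformPricing.HasNeedles 𝓓 N := by
    rcases h𝓓 with ⟨rfl, hN⟩ | ⟨rfl, hN⟩ | ⟨rfl, hN⟩
    · exact UniformPricing.hasNeedles_regular hN
    · exact UniformPricing.hasNeedles_mhr hN
    · exact (UniformPricing.hasNeedles_regular hN).mono fun D hD => hD.1
  refine ⟨fun ε hε hε' => ?_, fun T hT => ?_⟩
  · have hlow := UniformPricing.le_queryComplexity hn hε hε'
    have hup := UniformPricing.sureQueryComplexity_le 𝓓 N hε (by linarith)
    have hle := UniformPricing.queryComplexity_le_sureQueryComplexity 𝓓 N ε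
    exact ⟨hlow, hle.trans hup, hlow.trans hle, hup⟩
  · refine ⟨UniformPricing.le_minimaxRegret hn hT,
      (UniformPricing.minimaxRegret_le 𝓓 N hT).trans (EReal.coe_le_coe ?_)⟩
    gcongr
    norm_num
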